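/- Let $\tau$ be a finite vocabulary consisting of predicates only, each of arity $\ge 1$, with $\in\;\notin\tau$, and put $\tau^+=\tau\cup\{\in\}$. For a $\tau$-model $M$, regard the elements of $M$ as urelements and let $V_0[M]=M$, $V_{t+1}[M]=V_t[M]\cup\{a:a\subseteq V_t[M]\}$, with $\in$ interpreted as membership (urelements have no members) and the predicates of $\tau$ interpreted as in $M$. An *inductive scheme* $\Upsilon$ consists of finitely many unary predicates $\mathcal P_\ell$ ($\ell<m_1$, where $m_1\ge 2$), first order formulas $\psi_k(x;\bar y_k)$ ($k<m_0$) and first order formulas $\varphi_\ell(x)$ ($\ell<m_1$), all in the vocabulary $\tau^+\cup\{\mathcal P_\ell:\ell<m_1\}$. Put $N_0=M$ with all $\mathcal P_\ell$ empty. Given $N_t\subseteq V_t[M]$, and writing $N_t^+$ for $N_t$ expanded by the predicates $\mathcal P_\ell$ at stage $t$, let $$\mathcal P_{t,k}=\bigl\{\{a\in N_t:N_t^+\models\psi_k(a,\bar b)\}:\bar b\in{}^{\mathrm{lg}(\bar y_k)}N_t\bigr\},\qquad c_{t,\ell}=\{a\in N_t:N_t^+\models\varphi_\ell(a)\},$$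 let $N_{t+1}=N_t\cup\bigcup_{k<m_0}\mathcal P_{t,k}$, and let $\mathcal P_\ell$ hold in $N_{t+1}^+$ of $c_{t,\ell}$ only (of nothing, if $c_{t,\ell}\notin N_{t+1}$). The scheme is *standard* if $\{s:s<t\}\subseteq N_t$ for all finite nonempty $M$ and all $t\in\mathbb N$, where natural numbers are identified with von Neumann numerals. For rational $q>0$ let $f_q(n)=\lceil n^q\rceil$, and let $\mathbf T_{\mathrm{pol}}=\{f_q:q\in\mathbb Q,\ q>0\}$. A sentence of the choiceless polynomial time logic $\mathcal L_4^{\mathbf T_{\mathrm{pol}}}[\mathcal L_{\mathrm{f.o.}}](\tau)$ is $\theta=\theta_{\Upsilon,\chi,\mathbf t}$ with $\Upsilon$ a standard inductive scheme, $\chi$ a first order sentence in the vocabulary $\tau^+$, and $\mathbf t\in\mathbf T_{\mathrm{pol}}$. For a finite $\tau$-model $M$, the stopping time is the least $t$ such that $c_{t,0}=c_{t,1}$ or some $\mathcal P_{t+1,k}$ has more than $\mathbf t(\|M\|)$ members. If it exists and $c_{t,0}=c_{t,1}$ holds at it, then $\theta$ is true in $M$ ($M\models\theta$) if $N_t\models\chi$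 and false in $M$ ($M\models\neg\theta$) if $N_t\models\neg\chi$; otherwise the truth value of $\theta$ in $M$ is undefined. For each predicate $R\in\tau$ fix a probability $p_R\in[0,1]$, and let $M_n$ be the random $\tau$-model with universe $\{0,\dots,n-1\}$ in which, independently for all $R\in\tau$ and all tuples $\bar a$ of the right length (repetitions allowed), $R(\bar a)$ holds with probability $p_R$. **Theorem (0-1 law).** For every sentence $\theta$ of $\mathcal L_4^{\mathbf T_{\mathrm{pol}}}[\mathcal L_{\mathrm{f.o.}}](\tau)$, there is a truth value such that $\theta$ almost surely takes no other one: $\Pr(M_n\models\neg\theta)\to 0$ or $\Pr(M_n\models\theta)\to 0$ as $n\to\infty$. In particular, if the probability that the truth value of $\theta$ in $M_n$ is undefined tends to $0$, then $\Pr(M_n\models\theta)$ tends to $1$ or to $0$. -/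

import Mathlib

open Set Filter Topology MeasureTheory ProbabilityTheory

universe u v w

namespace CPT

/-! ### Vocabularies -/

inductive MemRel : ℕ → Type
  | mem : MemRel 2

/-- The vocabulary `{∈}`. -/
def memLang : FirstOrder.Language.{0, 0} := ⟨fun _ => Empty, MemRel⟩

inductive PredRel (m : ℕ) : ℕ → Type
  | pred : Fin m → PredRel m 1

/-- The vocabulary consisting of unary predicates `𝒫_ℓ`, `ℓ < m`. -/
def predLang (m : ℕ) : FirstOrder.Language.{0, 0} := ⟨fun _ => Empty, PredRel m⟩

/-- `τ⁺ = τ ∪ {∈}`. -/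
abbrev plusLang (L : FirstOrder.Language.{u, v}) : FirstOrder.Language := L.sum memLang

/-- `τ₂ = τ⁺ ∪ {𝒫_ℓ : ℓ < m}`. -/
abbrev stageLang (L : FirstOrder.Language.{u, v}) (m : ℕ) : FirstOrder.Language := (plusLang L).sum (predLang m)

/-! ### Sets over urelements -/

/-- The universe of `V_t[M]`: `V_0 = M`, and `V_{t+1} = V_t ∪ {a : a ⊆ V_t}` consists of the
urelements (elements of `M`) and of all the subsets of `V_t`, because every set in `V_t` is a
subset of `V_t`. -/
@[reducible] def Level (M : Type w) : ℕ → Type w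
  | 0 => M
  | t + 1 => M ⊕ Set (Level M t)

namespace Level

variable {M : Type w}

/-- An element of `M`, as a member of `V_t`. -/
def atom : (t : ℕ) → M → Level M t
  | 0, a => a
  | _ + 1, a => Sum.inl a

/-- A subset of `V_t`, as a member of `V_{t+1}`. -/
def ofSet {t : ℕ} (s : Set (Level M t)) : Level M (t + 1) := Sum.inr s

/-- The inclusion `V_t ⊆ V_{t+1}`. -/
def lift : (t : ℕ) → Level M t → Level M (t + 1)
  | 0, a => Sum.inl a
  | _ + 1, Sum.inl a => Sum.inl a
  | t + 1, Sum.inr s => Sum.inr (lift t '' s)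

/-- `Mem t x y` is `x ∈ y` in `V_t`; urelements have no members. -/
def Mem : (t : ℕ) → Level M t → Level M t → Prop
  | 0, _, _ => False
  | _ + 1, _, Sum.inl _ => False
  | t + 1, x, Sum.inr s => ∃ y ∈ s, lift t y = x

/-- The (von Neumann) natural number `t = {0, …, t - 1}`, as a subset of `V_t`. -/
def numerals : (t : ℕ) → Set (Level M t)
  | 0 => ∅
  | t + 1 => lift t '' numerals t ∪ {ofSet (numerals t)}

end Level

/-! ### Inductive schemes and the structures `N_t[M]` -/

/-- An inductive scheme `Υ = (ψ̄, φ̄, 𝒫̄)` for first order logic over `τ⁺`. We ask for `m₁ ≥ 2`,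
since `c_{t,0}` and `c_{t,1}` are used for halting. In `ψ_k(x; ȳ)`, the variable `x` is
`Sum.inl ()` and the variables `ȳ` are the `Sum.inr j`. -/
structure Scheme (L : FirstOrder.Language.{u, v}) where
  m₀ : ℕ
  m₁ : ℕ
  two_le : 2 ≤ m₁
  arity : Fin m₀ → ℕ
  ψ : (k : Fin m₀) → (stageLang L m₁).Formula (Unit ⊕ Fin (arity k))
  φ : Fin m₁ → (stageLang L m₁).Formula Unit

/-- The universe of `N_t` as a subset of `V_t`, with the predicates `𝒫_ℓ` at stage `t`. -/
structure Stage (M : Type w) (m t : ℕ) where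
  carrier : Set (Level M t)
  pred : Fin m → Set (Level M t)

namespace Stage

variable {L : FirstOrder.Language.{u, v}} [L.IsRelational] {M : Type w} [L.Structure M] {m t : ℕ}

/-- The predicates of `τ` are interpreted in `N_t` as in `M`: they hold of tuples of urelements
only. -/
instance baseStructure (S : Stage M m t) : L.Structure S.carrier where
  funMap := fun {_} f => isEmptyElim f
  RelMap := fun {l} R x =>
    ∃ a : Fin l → M, (∀ i, (x i : Level M t) = Level.atom t (a i)) ∧ FirstOrder.Language.Structure.RelMap R a

instance memStructure (S : Stage M m t) : memLang.Structure S.carrier where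
  funMap := fun {_} f => Empty.elim f
  RelMap := fun {_} R => match R with
    | MemRel.mem => fun x => Level.Mem t (x 0 : Level M t) (x 1 : Level M t)

instance predStructure (S : Stage M m t) : (predLang m).Structure S.carrier where
  funMap := fun {_} f => Empty.elim f
  RelMap := fun {_} R => match R with
    | PredRel.pred ℓ => fun x => (x 0 : Level M t) ∈ S.pred ℓ

end Stage

namespace Scheme

variable {L : FirstOrder.Language.{u, v}} [L.IsRelational] (Υ : Scheme L)

section Run

variable {M : Type w} [L.Structure M] {t : ℕ}

/-- The family `{ {a ∈ N_t : N_t⁺ ⊨ ψ_k(a, b̄)} : b̄ ∈ N_t }`. -/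
def family (S : Stage M Υ.m₁ t) (k : Fin Υ.m₀) : Set (Set (Level M t)) :=
  {X | ∃ b : Fin (Υ.arity k) → S.carrier,
    X = {a | ∃ ha : a ∈ S.carrier, (Υ.ψ k).Realize (Sum.elim (fun _ => ⟨a, ha⟩) b)}}

/-- The set `c_{t,ℓ} = {a ∈ N_t : N_t⁺ ⊨ φ_ℓ(a)}`. -/
def constant (S : Stage M Υ.m₁ t) (ℓ : Fin Υ.m₁) : Set (Level M t) :=
  {a | ∃ ha : a ∈ S.carrier, (Υ.φ ℓ).Realize (fun _ : Unit => (⟨a, ha⟩ : S.carrier))}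

end Run

variable (M : Type w) [L.Structure M]

/-- `N_t[M, Υ]` with its predicates. At stage `0` the universe is `M` and the predicates are empty;
the universe of `N_{t+1}` is `N_t` together with all members of the families of stage `t`, and
`𝒫_ℓ` is interpreted at stage `t + 1` as `{c_{t,ℓ}}` (so it is empty on `N_{t+1}` if `c_{t,ℓ}` is
not an element of `N_{t+1}`). -/
def stage : (t : ℕ) → Stage M Υ.m₁ t
  | 0 => ⟨Set.univ, fun _ => ∅⟩
  | t + 1 =>
    ⟨Level.lift t '' (stage t).carrier ∪ Level.ofSet '' ⋃ k, Υ.family (stage t) k,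
      fun ℓ => {Level.ofSet (Υ.constant (stage t) ℓ)}⟩

/-- `Υ` is standard: `{s : s < t} ⊆ N_t[M, Υ]` for all (nonempty, finite) `M` and all `t`. -/
def IsStandard : Prop :=
  ∀ (M : Type) [Finite M] [Nonempty M] [L.Structure M] (t : ℕ),
    Level.numerals t ⊆ (Υ.stage M t).carrier

/-- The halting condition `c_{t,0} = c_{t,1}`. -/
def Halts (t : ℕ) : Prop :=
  Υ.constant (Υ.stage M t) ⟨0, by have := Υ.two_le; omega⟩ =
    Υ.constant (Υ.stage M t) ⟨1, by have := Υ.two_le; omega⟩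

/-- The resource bound `b` is exceeded: some family `𝒫_{t+1,k}` has more than `b` members. -/
def Exceeds (b t : ℕ) : Prop :=
  ∃ k, (b : ℕ∞) < (Υ.family (Υ.stage M (t + 1)) k).encard

/-- `t` is the stopping time, i.e. the first stage at which either the computation halts or the
bound `b` is exceeded. -/
def IsStoppingTime (b t : ℕ) : Prop :=
  IsLeast {s | Υ.Halts M s ∨ Υ.Exceeds M b s} t

end Scheme

/-! ### The logic -/

/-- `f_q(n) = ⌈n ^ q⌉`. -/
noncomputable def polyBound (q : ℚ) (n : ℕ) : ℕ := ⌈(n : ℝ) ^ (q : ℝ)⌉₊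

/-- A sentence `θ_{Υ,χ,𝐭}` of the choiceless polynomial time logic: `Υ` is a standard inductive
scheme, `χ` a first order sentence over `τ⁺`, and `𝐭 = f_q` with `q > 0` rational. -/
structure PolySentence (L : FirstOrder.Language.{u, v}) [L.IsRelational] where
  scheme : Scheme L
  standard : scheme.IsStandard
  χ : (plusLang L).Sentence
  q : ℚ
  q_pos : 0 < q

namespace PolySentence

variable {L : FirstOrder.Language.{u, v}} [L.IsRelational] (θ : PolySentence L) (M : Type w) [L.Structure M]

/-- `t` is the stopping time for the bound `𝐭(‖M‖)`, and the computation halts at `t` (and so was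
not merely stopped for lack of resources). -/
def HaltsInTime (t : ℕ) : Prop :=
  θ.scheme.IsStoppingTime M (polyBound θ.q (Nat.card M)) t ∧ θ.scheme.Halts M t

/-- `M ⊨ θ`. -/
def IsTrue : Prop :=
  ∃ t, θ.HaltsInTime M t ∧ θ.χ.Realize (θ.scheme.stage M t).carrier

/-- `M ⊨ ¬θ`. -/
def IsFalse : Prop :=
  ∃ t, θ.HaltsInTime M t ∧ ¬ θ.χ.Realize (θ.scheme.stage M t).carrier

/-- The truth value of `θ` in `M` is undefined. -/
def IsUndefined : Prop := ¬ ∃ t, θ.HaltsInTime M t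

end PolySentence

/-! ### Random models -/

/-- The atomic statements `R(x₁, …, x_l)` about the universe `{0, …, n - 1}`. -/
abbrev Atomic (L : FirstOrder.Language.{u, v}) (n : ℕ) : Type v :=
  Σ R : (Σ l, L.Relations l), (Fin R.1 → Fin n)

/-- The `τ`-model on `{0, …, n - 1}` in which exactly the atomic statements in `ω` hold. -/
abbrev modelOf {L : FirstOrder.Language.{u, v}} [L.IsRelational] {n : ℕ} (ω : Atomic L n → Bool) :
    L.Structure (Fin n) where
  funMap := fun {_} f => isEmptyElim f
  RelMap := fun {l} R x => ω ⟨⟨l, R⟩, x⟩ = true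

/-- The random `τ`-model on `{0, …, n - 1}`: the atomic statements are independent, and those with
predicate `R` hold with probability `p R`. -/
noncomputable def randomModel (L : FirstOrder.Language.{u, v}) [Fintype (Σ l, L.Relations l)]
    (p : (Σ l, L.Relations l) → unitInterval) (n : ℕ) : Measure (Atomic L n → Bool) :=
  Measure.pi fun x : Atomic L n => bernoulliMeasure true false (p x.1)

namespace PolySentence

variable {L : FirstOrder.Language.{u, v}} [L.IsRelational] [Fintype (Σ l, L.Relations l)]
  (p : (Σ l, L.Relations l) → unitInterval) (θ : PolySentence L) (n : ℕ)

/-- The probability that `θ` is true in the random model with `n` elements. -/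
noncomputable def probTrue : ℝ :=
  (randomModel L p n).real {ω | letI := modelOf ω; θ.IsTrue (Fin n)}

/-- The probability that `θ` is false in the random model with `n` elements. -/
noncomputable def probFalse : ℝ :=
  (randomModel L p n).real {ω | letI := modelOf ω; θ.IsFalse (Fin n)}

/-- The probability that `θ` has no truth value in the random model with `n` elements. -/
noncomputable def probUndefined : ℝ :=
  (randomModel L p n).real {ω | letI := modelOf ω; θ.IsUndefined (Fin n)}

end PolySentence

end CPT

/-! Generic structures, even of different sizes, cannot disagree on a sentence that has a truth
value in both, and random structures are almost surely generic. Here genericity means the extension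
axioms over at most `K` points, with witnesses in each of `K * r` blocks of the universe, where `r`
is about `√(n / K)`; it holds almost surely by a union bound (`tendsto_real_not_isGeneric`).

A random structure may have no automorphisms, so symmetry is expressed by finite partial
isomorphisms, which act on the hereditary sets of `N_t` through `Sim`. As long as all elements have
supports of at most `k` points, images are unique (`eq_of_sim`), compose (`sim_comp`) and respect
membership (`sim_mem_iff`). A back-and-forth argument in which each move costs at most `k` points
then shows that formulas of bounded quantifier depth do not distinguish an element from its image
(`realize_iff_of_pred`).

The bound `k` persists from stage to stage because the families are small. The supports of its
parameters support a member `X` of a family. If a support `S` of `X` has more than `k` points, then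
choosing a block for each point gives `r ^ |S|` embeddings of `S`, more than the family has members,
so two of them give the same image of `X`. Then `X` is already supported by the proper subset of `S`
on which they agree (`isFamilySupport_of_image_eq`, `exists_small_support`). For `k = 2 * Q + 1` the
number `r ^ (k + 1)` exceeds the resource bound `n ^ Q`, and neither `k` nor `K` depends on the
number of stages.

This applies up to the earliest stopping time among the structures considered. At that stage,
halting and the truth value of `χ` are the same in all of them (`not_isTrue_and_isFalse`). So one
large generic structure in which the sentence is true prevents it from being false in any large
generic structure. -/

namespace CPT

open FirstOrder FirstOrder.Language FirstOrder.Language.Structure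

open scoped Classical in
section

/-! ### Finite partial maps -/

namespace PMap

variable {A B C : Type w}

/-- The inverse of a finite relation. -/
noncomputable def inv (f : Finset (A × B)) : Finset (B × A) := f.image Prod.swap

/-- The relational composition, first `f` and then `g`. -/
noncomputable def comp (f : Finset (A × B)) (g : Finset (B × C)) : Finset (A × C) :=
  ((f ×ˢ g).filter fun p => p.1.2 = p.2.1).image fun p => (p.1.1, p.2.2)

noncomputable def dom (f : Finset (A × B)) : Finset A := f.image Prod.fst

noncomputable def ran (f : Finset (A × B)) : Finset B := f.image Prod.snd

noncomputable def res (f : Finset (A × B)) (S : Finset A) : Finset (A × B) :=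
  f.filter fun p => p.1 ∈ S

@[simp] lemma mem_inv {f : Finset (A × B)} {a : A} {b : B} : (b, a) ∈ inv f ↔ (a, b) ∈ f := by
  simp [inv]

@[simp] lemma mem_comp {f : Finset (A × B)} {g : Finset (B × C)} {a : A} {c : C} :
    (a, c) ∈ comp f g ↔ ∃ b, (a, b) ∈ f ∧ (b, c) ∈ g := by
  simp only [comp, Finset.mem_image, Finset.mem_filter, Finset.mem_product, Prod.exists,
    Prod.mk.injEq]
  constructor
  · rintro ⟨x, y, y', z, ⟨⟨h1, h2⟩, h⟩, rfl, rfl⟩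
    exact ⟨y, h1, by simpa [h] using h2⟩
  · rintro ⟨b, h1, h2⟩
    exact ⟨a, b, b, c, ⟨⟨h1, h2⟩, rfl⟩, rfl, rfl⟩

@[simp] lemma mem_dom {f : Finset (A × B)} {a : A} : a ∈ dom f ↔ ∃ b, (a, b) ∈ f := by
  simp [dom]

@[simp] lemma mem_ran {f : Finset (A × B)} {b : B} : b ∈ ran f ↔ ∃ a, (a, b) ∈ f := by
  simp [ran]

@[simp] lemma mem_res {f : Finset (A × B)} {S : Finset A} {a : A} {b : B} :
    (a, b) ∈ res f S ↔ (a, b) ∈ f ∧ a ∈ S := by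
  simp [res]

lemma res_subset (f : Finset (A × B)) (S : Finset A) : res f S ⊆ f := Finset.filter_subset _ _

@[simp] lemma inv_inv (f : Finset (A × B)) : inv (inv f) = f := by
  ext ⟨a, b⟩; simp

lemma inv_union (f g : Finset (A × B)) : inv (f ∪ g) = inv f ∪ inv g := Finset.image_union ..

lemma inv_mono {f g : Finset (A × B)} (h : f ⊆ g) : inv f ⊆ inv g := Finset.image_subset_image h

lemma card_inv (f : Finset (A × B)) : (inv f).card = f.card :=
  Finset.card_image_of_injective _ Prod.swap_injective

lemma card_ran_le (f : Finset (A × B)) : (ran f).card ≤ f.card := Finset.card_image_le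

lemma ran_inv (f : Finset (A × B)) : ran (inv f) = dom f := by
  ext b; simp

lemma dom_mono {f g : Finset (A × B)} (h : f ⊆ g) : dom f ⊆ dom g := Finset.image_subset_image h

lemma subset_dom_res {f : Finset (A × B)} {S : Finset A} (h : S ⊆ dom f) : dom (res f S) = S := by
  ext a
  simp only [mem_dom, mem_res]
  constructor
  · rintro ⟨b, -, h⟩; exact h
  · intro ha
    obtain ⟨b, hb⟩ := mem_dom.1 (h ha)
    exact ⟨b, hb, ha⟩

end PMap

open PMap

/-! ### Partial isomorphisms -/

variable {L : FirstOrder.Language.{u, v}} {A B C : Type w} [L.Structure A] [L.Structure B]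
  [L.Structure C]

variable (L) in
/-- A finite partial isomorphism between relational structures. -/
structure IsPartialIso (f : Finset (A × B)) : Prop where
  eq_iff : ∀ x ∈ f, ∀ y ∈ f, x.1 = y.1 ↔ x.2 = y.2
  rel_iff : ∀ {l : ℕ} (R : L.Relations l) (z : Fin l → A × B), (∀ m, z m ∈ f) →
    (RelMap R (fun m => (z m).1) ↔ RelMap R (fun m => (z m).2))

namespace IsPartialIso

variable {f g : Finset (A × B)}

lemma mono (hg : IsPartialIso L g) (h : f ⊆ g) : IsPartialIso L f :=
  ⟨fun x hx y hy => hg.eq_iff x (h hx) y (h hy), fun R z hz => hg.rel_iff R z fun m => h (hz m)⟩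

lemma snd_eq (hf : IsPartialIso L f) {a : A} {b b' : B} (h : (a, b) ∈ f) (h' : (a, b') ∈ f) :
    b = b' := (hf.eq_iff _ h _ h').1 rfl

lemma fst_eq (hf : IsPartialIso L f) {a a' : A} {b : B} (h : (a, b) ∈ f) (h' : (a', b) ∈ f) :
    a = a' := (hf.eq_iff _ h _ h').2 rfl

lemma inv (hf : IsPartialIso L f) : IsPartialIso L (inv f) := by
  refine ⟨?_, ?_⟩
  · rintro ⟨b, a⟩ h ⟨b', a'⟩ h'
    exact (hf.eq_iff (a, b) (mem_inv.1 h) (a', b') (mem_inv.1 h')).symm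
  · intro l R z hz
    exact (hf.rel_iff R (fun m => ((z m).2, (z m).1)) fun m => mem_inv.1 (hz m)).symm

lemma comp {g : Finset (B × C)} (hf : IsPartialIso L f) (hg : IsPartialIso L g) :
    IsPartialIso L (comp f g) := by
  refine ⟨?_, ?_⟩
  · rintro ⟨a, c⟩ h ⟨a', c'⟩ h'
    obtain ⟨b, h1, h2⟩ := mem_comp.1 h
    obtain ⟨b', h1', h2'⟩ := mem_comp.1 h'
    exact (hf.eq_iff _ h1 _ h1').trans (hg.eq_iff _ h2 _ h2')
  · intro l R z hz
    choose b h1 h2 using fun m => mem_comp.1 (hz m)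
    exact (hf.rel_iff R (fun m => ((z m).1, b m)) h1).trans
      (hg.rel_iff R (fun m => (b m, (z m).2)) h2)

/-- Only a predicate of arity 0 could tell two structures apart without any points. This is where
arity at least 1 is needed. -/
lemma empty [IsEmpty (L.Relations 0)] : IsPartialIso L (∅ : Finset (A × B)) := by
  refine ⟨by simp, ?_⟩
  intro l R z hz
  match l with
  | 0 => exact isEmptyElim R
  | l + 1 => simpa using hz 0

lemma res (hf : IsPartialIso L f) (S : Finset A) : IsPartialIso L (res f S) :=
  hf.mono (res_subset f S)

lemma card_res_le (hf : IsPartialIso L f) (S : Finset A) : (PMap.res f S).card ≤ S.card := by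
  refine Finset.card_le_card_of_injOn Prod.fst ?_ ?_
  · rintro ⟨a, b⟩ h
    exact (mem_res.1 h).2
  · intro x hx y hy hxy
    have hx := res_subset _ _ hx
    have hy := res_subset _ _ hy
    exact Prod.ext hxy ((hf.eq_iff _ hx _ hy).1 hxy)

lemma card_le_card_dom (hf : IsPartialIso L f) : f.card ≤ (dom f).card := by
  have h : f = PMap.res f (dom f) := by
    ext ⟨a, c⟩
    simp only [mem_res, mem_dom, iff_self_and]
    exact fun h => ⟨c, h⟩
  conv_lhs => rw [h]
  exact hf.card_res_le _

lemma card_comp_le {g : Finset (B × C)} (hf : IsPartialIso L f) (hg : IsPartialIso L g) :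
    (PMap.comp f g).card ≤ f.card := by
  have h : dom (PMap.comp f g) ⊆ dom f := by
    intro a
    simp only [mem_comp, mem_dom]
    rintro ⟨c, b, hb, -⟩
    exact ⟨b, hb⟩
  exact ((hf.comp hg).card_le_card_dom.trans (Finset.card_le_card h)).trans Finset.card_image_le

/-- If `dom g ⊆ ran f`, then `g` is contained in `f⁻¹` followed by any map extending `f; g`. -/
lemma subset_comp_inv {h : Finset (B × C)} {e : Finset (A × B)} {k : Finset (A × C)}
    (hfe : f ⊆ e) (hk : PMap.comp f h ⊆ k) (hd : dom h ⊆ ran f) : h ⊆ PMap.comp (PMap.inv e) k := by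
  rintro ⟨b, c⟩ hbc
  obtain ⟨a, ha⟩ := mem_ran.1 (hd (mem_dom.2 ⟨c, hbc⟩))
  exact mem_comp.2 ⟨a, mem_inv.2 (hfe ha), hk (mem_comp.2 ⟨b, ha, hbc⟩)⟩

end IsPartialIso

/-! ### Generic structures -/

/-- `b` realizes the type `τ` over `C`; the new element is denoted by `none`. -/
def Realizes (C : Finset A) (τ : (R : Σ l, L.Relations l) → (Fin R.1 → Option A) → Prop)
    (b : A) : Prop :=
  ∀ (R : Σ l, L.Relations l) (z : Fin R.1 → Option A), (∀ m, ∀ y ∈ z m, y ∈ C) →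
    (∃ m, z m = none) → (RelMap R.2 (fun m => (z m).getD b) ↔ τ R z)

/-- The predicates in `P₀` are empty, those in `P₁` are full, and all other one-point extensions
of sets with at most `K` elements are realized, in each of the `K * r` blocks
`{b : blk b = (i, j)}`. -/
structure IsGeneric (P₀ P₁ : (Σ l, L.Relations l) → Prop) (K r : ℕ) (blk : A → ℕ × ℕ) : Prop where
  not_rel : ∀ R : Σ l, L.Relations l, P₀ R → ∀ x : Fin R.1 → A, ¬ RelMap R.2 x
  rel : ∀ R : Σ l, L.Relations l, P₁ R → ∀ x : Fin R.1 → A, RelMap R.2 x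
  exists_realizes : ∀ C : Finset A, C.card ≤ K →
    ∀ τ : (R : Σ l, L.Relations l) → (Fin R.1 → Option A) → Prop,
      (∀ R, P₀ R → ∀ z, ¬ τ R z) → (∀ R, P₁ R → ∀ z, τ R z) →
      ∀ i < K, ∀ j < r, ∃ b ∉ C, blk b = (i, j) ∧ Realizes C τ b

namespace IsGeneric

variable {P₀ P₁ : (Σ l, L.Relations l) → Prop} {K r r' : ℕ} {blk : A → ℕ × ℕ} {blk' : B → ℕ × ℕ}

/-- Two partial isomorphisms whose ranges meet only where they agree have a common one-point
extension. -/
lemma exists_insert₂ (hA : IsGeneric P₀ P₁ K r blk) (hB : IsGeneric P₀ P₁ K r' blk')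
    {g₁ g₂ : Finset (A × B)} (h₁ : IsPartialIso L g₁) (h₂ : IsPartialIso L g₂)
    (hc : ∀ x x' y, (x, y) ∈ g₁ → (x', y) ∈ g₂ → x = x') (E : Finset B)
    (hK : g₁.card + g₂.card + E.card ≤ K) {a : A} (ha₁ : a ∉ dom g₁) (ha₂ : a ∉ dom g₂)
    {i j : ℕ} (hi : i < K) (hj : j < r') :
    ∃ b, b ∉ E ∧ b ∉ ran g₁ ∧ b ∉ ran g₂ ∧ blk' b = (i, j) ∧
      IsPartialIso L (insert (a, b) g₁) ∧ IsPartialIso L (insert (a, b) g₂) := by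
  let G : Finset (A × B) → A → Option B → Prop := fun g x o =>
    (o = none ∧ x = a) ∨ ∃ y, o = some y ∧ (x, y) ∈ g
  have hG : ∀ g g', (∀ x x' y, (x, y) ∈ g → (x', y) ∈ g' → x = x') →
      ∀ x x' o, G g x o → G g' x' o → x = x' := by
    rintro g g' h x x' o (⟨rfl, rfl⟩ | ⟨y, rfl, hy⟩) (⟨h0, rfl⟩ | ⟨y', h0, hy'⟩)
    · rfl
    · simp at h0
    · simp at h0
    · cases h0
      exact h _ _ _ hy hy'
  -- The type copies the relations of `A` along both maps at once. By `hc` a tuple of values has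
  -- only one tuple of preimages, so the two descriptions do not conflict; the disjunct `P₁ R` makes
  -- the type admissible.
  let τ : (R : Σ l, L.Relations l) → (Fin R.1 → Option B) → Prop := fun R z =>
    P₁ R ∨ (∃ x : Fin R.1 → A, (∀ m, G g₁ (x m) (z m)) ∧ RelMap R.2 x) ∨
      (∃ x : Fin R.1 → A, (∀ m, G g₂ (x m) (z m)) ∧ RelMap R.2 x)
  by_cases hP : ∃ R, P₀ R ∧ P₁ R
  · obtain ⟨R, h0, h1⟩ := hP
    exact absurd (hA.rel R h1 fun _ => a) (hA.not_rel R h0 _)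
  obtain ⟨b, hbC, hblk, hb⟩ := hB.exists_realizes (ran g₁ ∪ ran g₂ ∪ E)
    (by
      have := Finset.card_union_le (ran g₁ ∪ ran g₂) E
      have := Finset.card_union_le (ran g₁) (ran g₂)
      have := card_ran_le g₁
      have := card_ran_le g₂
      omega) τ
    (by
      rintro R h0 z (h | ⟨x, -, h⟩ | ⟨x, -, h⟩)
      · exact hP ⟨R, h0, h⟩
      · exact hA.not_rel R h0 x h
      · exact hA.not_rel R h0 x h)
    (fun R h1 z => Or.inl h1) i hi j hj
  simp only [Finset.mem_union, not_or] at hbC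
  obtain ⟨⟨hb₁, hb₂⟩, hbE⟩ := hbC
  have key : ∀ g, IsPartialIso L g → a ∉ dom g → b ∉ ran g → ran g ⊆ ran g₁ ∪ ran g₂ ∪ E →
      (∀ (R : Σ l, L.Relations l) (x : Fin R.1 → A) z, (∀ m, G g (x m) (z m)) →
        (τ R z ↔ RelMap R.2 x)) → IsPartialIso L (insert (a, b) g) := by
    intro g hg hag hbg hsub hτ
    have hag' : ∀ y, (a, y) ∉ g := fun y hy => hag (mem_dom.2 ⟨y, hy⟩)
    have hbg' : ∀ x, (x, b) ∉ g := fun x hx => hbg (mem_ran.2 ⟨x, hx⟩)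
    refine ⟨?_, ?_⟩
    · rintro ⟨x, y⟩ h ⟨x', y'⟩ h'
      rcases Finset.mem_insert.1 h with e | e <;> rcases Finset.mem_insert.1 h' with e' | e'
      · cases e; cases e'; simp
      · cases e
        constructor
        · rintro rfl; exact absurd e' (hag' _)
        · rintro rfl; exact absurd e' (hbg' _)
      · cases e'
        constructor
        · intro q; simp only at q; subst q; exact absurd e (hag' _)
        · intro q; simp only at q; subst q; exact absurd e (hbg' _)
      · exact hg.eq_iff _ e _ e'
    · intro l R z hz
      by_cases hn : ∃ m, z m = (a, b)
      · let o : Fin l → Option B := fun m => if z m = (a, b) then none else some (z m).2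
        have hb' := hb ⟨l, R⟩ o (by
          intro m y hy
          simp only [o] at hy
          split_ifs at hy with h0
          · simp at hy
          · have hy : (z m).2 = y := by simpa using hy
            rw [← hy]
            exact hsub (mem_ran.2 ⟨(z m).1, (Finset.mem_insert.1 (hz m)).resolve_left h0⟩))
          (by
            obtain ⟨m, hm⟩ := hn
            exact ⟨m, by simp [o, hm]⟩)
        have e1 : (fun m => (o m).getD b) = fun m => (z m).2 := by
          funext m
          simp only [o]
          split_ifs with h0
          · simp [h0]
          · simp
        rw [e1] at hb'
        rw [hb', hτ ⟨l, R⟩ (fun m => (z m).1) o]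
        intro m
        simp only [o]
        split_ifs with h0
        · exact Or.inl ⟨rfl, by simp [h0]⟩
        · exact Or.inr ⟨_, rfl, (Finset.mem_insert.1 (hz m)).resolve_left h0⟩
      · push Not at hn
        exact hg.rel_iff R z fun m => (Finset.mem_insert.1 (hz m)).resolve_left (hn m)
  refine ⟨b, hbE, hb₁, hb₂, hblk, key g₁ h₁ ha₁ hb₁ ?_ ?_, key g₂ h₂ ha₂ hb₂ ?_ ?_⟩
  · intro y hy; simp only [Finset.mem_union]; tauto
  · intro R x z hx
    constructor
    · rintro (h | ⟨x', hx', h⟩ | ⟨x', hx', h⟩)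
      · exact hA.rel R h x
      · rwa [show x = x' from funext fun m => hG g₁ g₁ (fun _ _ _ => h₁.fst_eq) _ _ _ (hx m) (hx' m)]
      · rwa [show x = x' from funext fun m => hG g₁ g₂ hc _ _ _ (hx m) (hx' m)]
    · intro h
      exact Or.inr (Or.inl ⟨x, hx, h⟩)
  · intro y hy; simp only [Finset.mem_union]; tauto
  · intro R x z hx
    constructor
    · rintro (h | ⟨x', hx', h⟩ | ⟨x', hx', h⟩)
      · exact hA.rel R h x
      · rwa [show x = x' from funext fun m => (hG g₁ g₂ hc _ _ _ (hx' m) (hx m)).symm]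
      · rwa [show x = x' from funext fun m => hG g₂ g₂ (fun _ _ _ => h₂.fst_eq) _ _ _ (hx m) (hx' m)]
    · intro h
      exact Or.inr (Or.inr ⟨x, hx, h⟩)

/-- The case `g₁ = g₂` of the previous lemma; counting `g` twice is the source of the factor 2 in
the size bounds below. -/
lemma exists_insert (hA : IsGeneric P₀ P₁ K r blk) (hB : IsGeneric P₀ P₁ K r' blk')
    {g : Finset (A × B)} (h : IsPartialIso L g) (E : Finset B)
    (hK : 2 * g.card + E.card ≤ K) {a : A} (ha : a ∉ dom g)
    {i j : ℕ} (hi : i < K) (hj : j < r') :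
    ∃ b, b ∉ E ∧ b ∉ ran g ∧ blk' b = (i, j) ∧ IsPartialIso L (insert (a, b) g) := by
  obtain ⟨b, h1, h2, -, h3, h4, -⟩ := hA.exists_insert₂ hB h h (fun _ _ _ => h.fst_eq) E
    (by omega) ha ha hi hj
  exact ⟨b, h1, h2, h3, h4⟩

/-- A common extension of two partial isomorphisms to a given finite set. -/
lemma exists_union₂ (hA : IsGeneric P₀ P₁ K r blk) (hB : IsGeneric P₀ P₁ K r' blk') (hr : 0 < r')
    {g₁ g₂ : Finset (A × B)} (h₁ : IsPartialIso L g₁) (h₂ : IsPartialIso L g₂)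
    (hc : ∀ x x' y, (x, y) ∈ g₁ → (x', y) ∈ g₂ → x = x') (D : Finset A)
    (hD₁ : Disjoint D (dom g₁)) (hD₂ : Disjoint D (dom g₂))
    (hK : g₁.card + g₂.card + 2 * D.card ≤ K) :
    ∃ W : Finset (A × B), W.card ≤ D.card ∧ D ⊆ dom W ∧
      IsPartialIso L (g₁ ∪ W) ∧ IsPartialIso L (g₂ ∪ W) := by
  -- The induction needs `dom W = D` exactly, and needs the compatibility `hc` to survive the
  -- extension.
  suffices H : ∃ W : Finset (A × B), W.card ≤ D.card ∧ dom W = D ∧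
      IsPartialIso L (g₁ ∪ W) ∧ IsPartialIso L (g₂ ∪ W) ∧
      ∀ x x' y, (x, y) ∈ g₁ ∪ W → (x', y) ∈ g₂ ∪ W → x = x' by
    obtain ⟨W, h1, h2, h3, h4, -⟩ := H
    exact ⟨W, h1, h2.ge, h3, h4⟩
  induction D using Finset.induction_on with
  | empty => exact ⟨∅, by simp, by ext; simp, by simpa using h₁, by simpa using h₂, by simpa using hc⟩
  | insert a D haD ih =>
    rw [Finset.card_insert_of_notMem haD] at hK
    rw [Finset.disjoint_insert_left] at hD₁ hD₂
    obtain ⟨W, hW1, hW2, hW3, hW4, hW5⟩ := ih hD₁.2 hD₂.2 (by omega)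
    have hc1 := Finset.card_union_le g₁ W
    have hc2 := Finset.card_union_le g₂ W
    have haW : ∀ g : Finset (A × B), a ∉ dom g → a ∉ dom (g ∪ W) := by
      intro g hg h
      obtain ⟨b, hb⟩ := mem_dom.1 h
      rcases Finset.mem_union.1 hb with hb | hb
      · exact hg (mem_dom.2 ⟨b, hb⟩)
      · exact haD (hW2 ▸ mem_dom.2 ⟨b, hb⟩)
    obtain ⟨b, -, hb1, hb2, -, hb3, hb4⟩ := hA.exists_insert₂ hB hW3 hW4 hW5 ∅
      (by simp; omega) (haW g₁ hD₁.1) (haW g₂ hD₂.1) (i := 0) (j := 0) (by omega) hr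
    refine ⟨insert (a, b) W, ?_, ?_, by rwa [Finset.union_insert], by rwa [Finset.union_insert], ?_⟩
    · rw [Finset.card_insert_of_notMem haD]
      exact (Finset.card_insert_le _ _).trans (by omega)
    · rw [← hW2]; ext x; simp only [mem_dom, Finset.mem_insert, Prod.mk.injEq]
      constructor
      · rintro ⟨y, ⟨rfl, rfl⟩ | h⟩
        · exact Or.inl rfl
        · exact Or.inr ⟨y, h⟩
      · rintro (rfl | ⟨y, h⟩)
        · exact ⟨b, Or.inl ⟨rfl, rfl⟩⟩
        · exact ⟨y, Or.inr h⟩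
    · intro x x' y hx hx'
      rw [Finset.union_insert, Finset.mem_insert] at hx hx'
      rcases hx with hx | hx <;> rcases hx' with hx' | hx'
      · cases hx; cases hx'; rfl
      · cases hx; exact absurd (mem_ran.2 ⟨_, hx'⟩) hb2
      · cases hx'; exact absurd (mem_ran.2 ⟨_, hx⟩) hb1
      · exact hW5 _ _ _ hx hx'

/-- A partial isomorphism extends to a given finite set, with new values outside of `E`. -/
lemma exists_extend_avoid (hA : IsGeneric P₀ P₁ K r blk) (hB : IsGeneric P₀ P₁ K r' blk')
    (hr : 0 < r') {g : Finset (A × B)} (h : IsPartialIso L g) (D : Finset A) (E : Finset B)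
    (hK : 2 * g.card + 2 * D.card + E.card ≤ K) :
    ∃ e : Finset (A × B), g ⊆ e ∧ IsPartialIso L e ∧ D ⊆ dom e ∧ e.card ≤ g.card + D.card ∧
      ∀ x y, (x, y) ∈ e → (x, y) ∉ g → y ∉ E := by
  induction D using Finset.induction_on with
  | empty => exact ⟨g, subset_rfl, h, by simp, by simp, fun x y h h' => absurd h h'⟩
  | insert a D haD ih =>
    rw [Finset.card_insert_of_notMem haD] at hK ⊢
    obtain ⟨e, h1, h2, h3, h4, h5⟩ := ih (by omega)
    by_cases hae : a ∈ dom e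
    · exact ⟨e, h1, h2, Finset.insert_subset hae h3, by omega, h5⟩
    obtain ⟨b, hb1, hb2, -, hb3⟩ := hA.exists_insert hB h2 E (by omega) hae (i := 0) (j := 0)
      (by omega) hr
    refine ⟨insert (a, b) e, h1.trans (Finset.subset_insert _ _), hb3,
      Finset.insert_subset (mem_dom.2 ⟨b, Finset.mem_insert_self _ _⟩)
        (h3.trans (dom_mono (Finset.subset_insert _ _))),
      (Finset.card_insert_le _ _).trans (by omega), ?_⟩
    intro x y hxy hn
    rcases Finset.mem_insert.1 hxy with hxy | hxy
    · cases hxy; exact hb1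
    · exact h5 x y hxy hn

lemma exists_extend (hA : IsGeneric P₀ P₁ K r blk) (hB : IsGeneric P₀ P₁ K r' blk')
    (hr : 0 < r') {g : Finset (A × B)} (h : IsPartialIso L g) (D : Finset A)
    (hK : 2 * g.card + 2 * D.card ≤ K) :
    ∃ e : Finset (A × B), g ⊆ e ∧ IsPartialIso L e ∧ D ⊆ dom e ∧ e.card ≤ g.card + D.card := by
  obtain ⟨e, h1, h2, h3, h4, -⟩ := hA.exists_extend_avoid hB hr h D ∅ (by simpa using hK)
  exact ⟨e, h1, h2, h3, h4⟩

/-- A finite set can be embedded with the values in prescribed blocks. -/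
lemma exists_embedding_blocks [IsEmpty (L.Relations 0)] (hA : IsGeneric P₀ P₁ K r blk)
    (S : Finset A) (hK : 2 * S.card ≤ K) (i j : A → ℕ) (hi : ∀ a ∈ S, i a < K)
    (hj : ∀ a ∈ S, j a < r) :
    ∃ e : Finset (A × A), IsPartialIso L e ∧ dom e = S ∧ ∀ x y, (x, y) ∈ e → blk y = (i x, j x) := by
  suffices H : ∃ e : Finset (A × A), e.card ≤ S.card ∧ IsPartialIso L e ∧ dom e = S ∧
      ∀ x y, (x, y) ∈ e → blk y = (i x, j x) by
    obtain ⟨e, -, h⟩ := H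
    exact ⟨e, h⟩
  induction S using Finset.induction_on with
  | empty => exact ⟨∅, by simp, IsPartialIso.empty, by ext; simp, by simp⟩
  | insert a S haS ih =>
    rw [Finset.card_insert_of_notMem haS] at hK ⊢
    obtain ⟨e, h1, h2, h3, h4⟩ := ih (by omega) (fun b hb => hi b (Finset.mem_insert_of_mem hb))
      (fun b hb => hj b (Finset.mem_insert_of_mem hb))
    obtain ⟨b, -, -, hb, hb'⟩ := hA.exists_insert hA h2 ∅ (by simp; omega) (h3 ▸ haS)
      (hi a (Finset.mem_insert_self _ _)) (hj a (Finset.mem_insert_self _ _))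
    refine ⟨insert (a, b) e, (Finset.card_insert_le _ _).trans (by omega), hb', ?_, ?_⟩
    · rw [← h3]; ext x; simp only [mem_dom, Finset.mem_insert, Prod.mk.injEq]
      constructor
      · rintro ⟨y, ⟨rfl, rfl⟩ | h⟩
        · exact Or.inl rfl
        · exact Or.inr ⟨y, h⟩
      · rintro (rfl | ⟨y, h⟩)
        · exact ⟨b, Or.inl ⟨rfl, rfl⟩⟩
        · exact ⟨y, Or.inr h⟩
    · intro x y hxy
      rcases Finset.mem_insert.1 hxy with hxy | hxy
      · cases hxy; exact hb
      · exact h4 x y hxy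

end IsGeneric

end

end CPT

/-! ### Images of hereditary sets under partial isomorphisms. -/

namespace CPT

open FirstOrder FirstOrder.Language FirstOrder.Language.Structure PMap

open scoped Classical in
section

variable {L : FirstOrder.Language.{u, v}} [L.IsRelational]

namespace Level

variable {M : Type w}

lemma lift_injective : ∀ t, Function.Injective (lift (M := M) t)
  | 0 => Sum.inl_injective
  | t + 1 => by
    rintro (a | s) (b | s') h
    · simpa [lift] using h
    · simp [lift] at h
    · simp [lift] at h
    · simp only [lift, Sum.inr.injEq] at h
      rw [(lift_injective t).image_injective h]

end Level

namespace Scheme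

variable (Υ : Scheme L)

/-- The universe of `N_t[A, Υ]`. -/
def nodes (A : Type w) [L.Structure A] (t : ℕ) : Set (Level A t) := (Υ.stage A t).carrier

variable {A B : Type w} [L.Structure A] [L.Structure B]

lemma lift_mem_nodes {t : ℕ} {x : Level A t} (hx : x ∈ Υ.nodes A t) :
    Level.lift t x ∈ Υ.nodes A (t + 1) := Or.inl ⟨x, hx, rfl⟩

lemma ofSet_mem_nodes {t : ℕ} {κ : Fin Υ.m₀} {X : Set (Level A t)}
    (hX : X ∈ Υ.family (Υ.stage A t) κ) : Level.ofSet X ∈ Υ.nodes A (t + 1) :=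
  Or.inr ⟨X, Set.mem_iUnion.2 ⟨κ, hX⟩, rfl⟩

lemma subset_nodes_of_mem_family {t : ℕ} {κ : Fin Υ.m₀} {X : Set (Level A t)}
    (hX : X ∈ Υ.family (Υ.stage A t) κ) : X ⊆ Υ.nodes A t := by
  obtain ⟨b, rfl⟩ := hX
  rintro a ⟨ha, -⟩
  exact ha

lemma constant_subset_nodes {t : ℕ} (ℓ : Fin Υ.m₁) :
    Υ.constant (Υ.stage A t) ℓ ⊆ Υ.nodes A t := by
  rintro a ⟨ha, -⟩
  exact ha

/-- The sets in `N_{t+1}` are subsets of `N_t`. -/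
lemma subset_nodes : ∀ {t : ℕ} {X : Set (Level A t)},
    (Sum.inr X : Level A (t + 1)) ∈ Υ.nodes A (t + 1) → X ⊆ Υ.nodes A t
  | 0, X, h => by
    rcases h with ⟨a, -, h⟩ | ⟨Y, hY, h⟩
    · simp [Level.lift] at h
    · obtain ⟨κ, hY⟩ := Set.mem_iUnion.1 hY
      cases h
      exact Υ.subset_nodes_of_mem_family hY
  | t + 1, X, h => by
    rcases h with ⟨x, hx, h⟩ | ⟨Y, hY, h⟩
    · rcases x with a | s
      · simp [Level.lift] at h
      · simp only [Level.lift, Sum.inr.injEq] at h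
        subst h
        rintro _ ⟨y, hy, rfl⟩
        exact Υ.lift_mem_nodes (subset_nodes hx hy)
    · obtain ⟨κ, hY⟩ := Set.mem_iUnion.1 hY
      cases h
      exact Υ.subset_nodes_of_mem_family hY

variable (k : ℕ)

/-- `Sim t f x x'` says that `x'` is the image of `x` under the partial isomorphism `f`. An
image of a set consists of the images of its elements under all partial isomorphisms which are
compatible with `f` and have size at most `k`. -/
def Sim : (t : ℕ) → Finset (A × B) → Level A t → Level B t → Prop
  | 0, f, a, b => (a, b) ∈ f
  | _ + 1, f, Sum.inl a, Sum.inl b => (a, b) ∈ f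
  | t + 1, f, Sum.inr X, Sum.inr Y => ∀ h : Finset (A × B), h.card ≤ k → IsPartialIso L (f ∪ h) →
      ∀ y ∈ Υ.nodes A t, ∀ y' ∈ Υ.nodes B t, Sim t h y y' → (y ∈ X ↔ y' ∈ Y)
  | _ + 1, _, Sum.inl _, Sum.inr _ => False
  | _ + 1, _, Sum.inr _, Sum.inl _ => False

/-- The relation `Sim (t + 1)` for sets. -/
def SetSim (t : ℕ) (f : Finset (A × B)) (X : Set (Level A t)) (Y : Set (Level B t)) : Prop :=
  ∀ h : Finset (A × B), h.card ≤ k → IsPartialIso L (f ∪ h) →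
    ∀ y ∈ Υ.nodes A t, ∀ y' ∈ Υ.nodes B t, Υ.Sim k t h y y' → (y ∈ X ↔ y' ∈ Y)

variable {Υ k} {t : ℕ} {f g : Finset (A × B)}

lemma sim_inr {X : Set (Level A t)} {Y : Set (Level B t)} :
    Υ.Sim k (t + 1) f (Sum.inr X) (Sum.inr Y) ↔ Υ.SetSim k t f X Y := by
  rw [Sim, SetSim]

/-- A larger map is compatible with fewer test maps `h`. -/
lemma SetSim.mono {X : Set (Level A t)} {Y : Set (Level B t)} (h : Υ.SetSim k t f X Y)
    (hfg : f ⊆ g) : Υ.SetSim k t g X Y :=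
  fun e he hg => h e he (hg.mono (Finset.union_subset_union_left hfg))

lemma Sim.mono (hfg : f ⊆ g) : ∀ {t : ℕ} {x : Level A t} {y : Level B t}, Υ.Sim k t f x y →
    Υ.Sim k t g x y
  | 0, _, _, h => by simp only [Sim] at h ⊢; exact hfg h
  | _ + 1, Sum.inl _, Sum.inl _, h => by simp only [Sim] at h ⊢; exact hfg h
  | _ + 1, Sum.inr _, Sum.inr _, h => sim_inr.2 ((sim_inr.1 h).mono hfg)
  | _ + 1, Sum.inl _, Sum.inr _, h => by simp [Sim] at h
  | _ + 1, Sum.inr _, Sum.inl _, h => by simp [Sim] at h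

lemma sim_inv_iff : ∀ {t : ℕ} {f : Finset (A × B)} {x : Level A t} {y : Level B t},
    Υ.Sim k t (inv f) y x ↔ Υ.Sim k t f x y
  | 0, _, _, _ => by simp only [Sim, mem_inv]
  | _ + 1, _, Sum.inl _, Sum.inl _ => by simp only [Sim, mem_inv]
  | t + 1, f, Sum.inr X, Sum.inr Y => by
    simp only [Sim]
    constructor
    · intro h e he hfe y hy y' hy' hyy'
      refine (h (inv e) (by rwa [card_inv]) ?_ y' hy' y hy (sim_inv_iff.2 hyy')).symm
      rw [← inv_union]
      exact hfe.inv
    · intro h e he hfe y hy y' hy' hyy'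
      refine (h (inv e) (by rwa [card_inv]) ?_ y' hy' y hy
        (sim_inv_iff.1 (by rwa [inv_inv]))).symm
      have := hfe.inv
      rwa [inv_union, inv_inv] at this
  | _ + 1, _, Sum.inl _, Sum.inr _ => by simp [Sim]
  | _ + 1, _, Sum.inr _, Sum.inl _ => by simp [Sim]

lemma Sim.inv {x : Level A t} {y : Level B t} (h : Υ.Sim k t f x y) :
    Υ.Sim k t (inv f) y x := sim_inv_iff.2 h

lemma SetSim.inv {X : Set (Level A t)} {Y : Set (Level B t)} (h : Υ.SetSim k t f X Y) :
    Υ.SetSim k t (inv f) Y X := sim_inr.1 (sim_inr.2 h).inv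

end Scheme

open Scheme

/-! ### Families of structures with supports -/

section Family

variable (L) in
/-- Finite partial isomorphisms between the structures `A i` extend to given finite sets, up to
size `K`. -/
def HasExtensions {ι : Type} (A : ι → Type w) [∀ i, L.Structure (A i)] (K : ℕ) : Prop :=
  ∀ i j, ∀ g : Finset (A i × A j), IsPartialIso L g → ∀ D : Finset (A i),
    2 * g.card + 2 * D.card ≤ K →
    ∃ e : Finset (A i × A j), g ⊆ e ∧ IsPartialIso L e ∧ D ⊆ dom e ∧ e.card ≤ g.card + D.card

variable {ι : Type} (A : ι → Type w) [∀ i, L.Structure (A i)] (Υ : Scheme L) (k : ℕ)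

/-- `S` is a support of `x` with at most `k` elements: all partial isomorphisms defined on `S` act
on `x`. -/
def IsSupport (t : ℕ) {i : ι} (x : Level (A i) t) (S : Finset (A i)) : Prop :=
  S.card ≤ k ∧ ∀ j, ∀ f : Finset (A i × A j), IsPartialIso L f → S ⊆ dom f →
    ∃ x' ∈ Υ.nodes (A j) t, Υ.Sim k t (res f S) x x'

/-- All elements of the structures `N_t[A i]` have supports with at most `k` elements. -/
def Supported (t : ℕ) : Prop := ∀ i, ∀ x ∈ Υ.nodes (A i) t, ∃ S, IsSupport A Υ k t x S

variable {A Υ k} {K : ℕ} (hE : HasExtensions L A K) {t : ℕ} {i j l : ι}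

include hE

/-- Images are unique: a candidate member `z` has a small support, so an extension of `f⁻¹` pulls it
back to some `x`. The pair `(x, z)` is then a legitimate test, and `x ∈ X` decides both `z ∈ Y` and
`z ∈ Y'`. -/
lemma eq_of_setSim (hS : Supported A Υ k t) {f : Finset (A i × A j)} (hf : IsPartialIso L f)
    (hK : 2 * f.card + 2 * k ≤ K) {X : Set (Level (A i) t)} {Y Y' : Set (Level (A j) t)}
    (hY : Y ⊆ Υ.nodes (A j) t) (hY' : Y' ⊆ Υ.nodes (A j) t) (h : Υ.SetSim k t f X Y)
    (h' : Υ.SetSim k t f X Y') : Y = Y' := by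
  have key : ∀ z ∈ Υ.nodes (A j) t, z ∈ Y ↔ z ∈ Y' := by
    intro z hz
    obtain ⟨S, hSk, hS⟩ := hS j z hz
    obtain ⟨e, hfe, he, hSe, -⟩ := hE j i (inv f) hf.inv S (by rw [card_inv]; omega)
    obtain ⟨x, hx, hzx⟩ := hS i e he hSe
    have h1 : IsPartialIso L (f ∪ inv (res e S)) := by
      refine he.inv.mono (Finset.union_subset ?_ (inv_mono (res_subset _ _)))
      rw [← inv_inv f]; exact inv_mono hfe
    have h2 : (inv (res e S)).card ≤ k := by
      rw [card_inv]; exact (he.card_res_le S).trans hSk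
    exact (h _ h2 h1 x hx z hz hzx.inv).symm.trans (h' _ h2 h1 x hx z hz hzx.inv)
  ext z
  exact ⟨fun h => (key z (hY h)).1 h, fun h => (key z (hY' h)).2 h⟩

lemma eq_of_sim (hS : ∀ s < t, Supported A Υ k s) {f : Finset (A i × A j)} (hf : IsPartialIso L f)
    (hK : 2 * f.card + 2 * k ≤ K) {x : Level (A i) t} {y y' : Level (A j) t}
    (hy : y ∈ Υ.nodes (A j) t) (hy' : y' ∈ Υ.nodes (A j) t) (h : Υ.Sim k t f x y)
    (h' : Υ.Sim k t f x y') : y = y' := by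
  match t, x, y, y' with
  | 0, x, y, y' =>
    simp only [Sim] at h h'
    exact hf.snd_eq h h'
  | t + 1, Sum.inl x, Sum.inl y, Sum.inl y' =>
    simp only [Sim] at h h'
    rw [hf.snd_eq h h']
  | t + 1, Sum.inr X, Sum.inr Y, Sum.inr Y' =>
    rw [eq_of_setSim hE (hS t (Nat.lt_succ_self t)) hf hK (Υ.subset_nodes hy) (Υ.subset_nodes hy')
      (sim_inr.1 h) (sim_inr.1 h')]
  | t + 1, Sum.inl x, Sum.inr y, _ => simp [Sim] at h
  | t + 1, Sum.inl x, _, Sum.inr y' => simp [Sim] at h'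
  | t + 1, Sum.inr x, Sum.inl y, _ => simp [Sim] at h
  | t + 1, Sum.inr x, _, Sum.inl y' => simp [Sim] at h'

lemma sim_eq_iff (hS : ∀ s < t, Supported A Υ k s) {f : Finset (A i × A j)}
    (hf : IsPartialIso L f) (hK : 2 * f.card + 2 * k ≤ K) {x y : Level (A i) t}
    {x' y' : Level (A j) t} (hx : x ∈ Υ.nodes (A i) t) (hy : y ∈ Υ.nodes (A i) t)
    (hx' : x' ∈ Υ.nodes (A j) t) (hy' : y' ∈ Υ.nodes (A j) t)
    (h : Υ.Sim k t f x x') (h' : Υ.Sim k t f y y') : x = y ↔ x' = y' := by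
  constructor
  · rintro rfl
    exact eq_of_sim hE hS hf hK hx' hy' h h'
  · rintro rfl
    exact eq_of_sim hE hS hf.inv (by rwa [card_inv]) hx hy h.inv h'.inv

/-- The forth step of the back-and-forth argument. The part `h` that moves `x` is kept small
separately, so that it can serve as a test map in `SetSim`. -/
lemma exists_sim_extend (hS : Supported A Υ k t) {f : Finset (A i × A j)}
    (hf : IsPartialIso L f) (hK : 2 * f.card + 2 * k ≤ K) {x : Level (A i) t}
    (hx : x ∈ Υ.nodes (A i) t) :
    ∃ e : Finset (A i × A j), f ⊆ e ∧ IsPartialIso L e ∧ e.card ≤ f.card + k ∧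
      ∃ h ⊆ e, h.card ≤ k ∧ ∃ x' ∈ Υ.nodes (A j) t, Υ.Sim k t h x x' := by
  obtain ⟨S, hSk, hS⟩ := hS i x hx
  obtain ⟨e, hfe, he, hSe, hc⟩ := hE i j f hf S (by omega)
  obtain ⟨x', hx', h⟩ := hS j e he hSe
  exact ⟨e, hfe, he, by omega, res e S, res_subset _ _, (he.card_res_le S).trans hSk, x', hx', h⟩

/-- A set is tested against elements of `N_t` at one level but of `N_{t+1}` at the next. The larger
class of tests gives nothing new: after an extension a member of `X` has an image in `N_t`, and by
uniqueness the lift of this image is the given `y'`. The bound `6 * k` pays for the test map, the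
extension and the uniqueness, `2 * k` each. -/
lemma sim_lift (hk : 8 * k ≤ K) : ∀ {t : ℕ}, (∀ s < t, Supported A Υ k s) →
    ∀ {i j : ι} {f : Finset (A i × A j)}, IsPartialIso L f → 2 * f.card + 6 * k ≤ K →
    ∀ {x : Level (A i) t} {y : Level (A j) t}, x ∈ Υ.nodes (A i) t → y ∈ Υ.nodes (A j) t →
    (Υ.Sim k (t + 1) f (Level.lift t x) (Level.lift t y) ↔ Υ.Sim k t f x y)
  | 0, hS, i, j, f, hf, hK, x, y, hx, hy => by simp only [Level.lift, Sim]
  | t + 1, hS, i, j, f, hf, hK, Sum.inl x, Sum.inl y, hx, hy => by simp only [Level.lift, Sim]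
  | t + 1, hS, i, j, f, hf, hK, Sum.inl x, Sum.inr y, hx, hy => by simp only [Level.lift, Sim]
  | t + 1, hS, i, j, f, hf, hK, Sum.inr x, Sum.inl y, hx, hy => by simp only [Level.lift, Sim]
  | t + 1, hS, i, j, f, hf, hK, Sum.inr X, Sum.inr Y, hx, hy => by
    have hS' : ∀ s < t, Supported A Υ k s := fun s hs => hS s (by omega)
    have hSt : Supported A Υ k t := hS t (by omega)
    have hX := Υ.subset_nodes hx
    have hY := Υ.subset_nodes hy
    have hinj := fun i => Level.lift_injective (M := A i) t
    -- Test maps have at most `k` pairs, so the recursive call needs `2 * k + 6 * k ≤ K`, which is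
    -- `hk`.
    have ih := fun {i j : ι} {f : Finset (A i × A j)} (hf : IsPartialIso L f) (hc : f.card ≤ k)
      {x : Level (A i) t} {y : Level (A j) t} => sim_lift hk hS' (f := f) (x := x) (y := y)
        hf (by omega)
    simp only [Level.lift]
    rw [sim_inr, sim_inr]
    constructor
    · intro H h hc hfh y hy y' hy' hyy'
      have := H h hc hfh _ (Υ.lift_mem_nodes hy) _ (Υ.lift_mem_nodes hy')
        ((ih (hfh.mono Finset.subset_union_right) hc hy hy').2 hyy')
      rwa [(hinj i).mem_set_image, (hinj j).mem_set_image] at this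
    · have key : ∀ {i j : ι} {f : Finset (A i × A j)} {X : Set (Level (A i) t)}
          {Y : Set (Level (A j) t)}, X ⊆ Υ.nodes (A i) t → 2 * f.card + 6 * k ≤ K →
          Υ.SetSim k t f X Y → ∀ h : Finset (A i × A j), h.card ≤ k → IsPartialIso L (f ∪ h) →
          ∀ y ∈ Υ.nodes (A i) (t + 1), ∀ y' ∈ Υ.nodes (A j) (t + 1), Υ.Sim k (t + 1) h y y' →
          y ∈ Level.lift t '' X → y' ∈ Level.lift t '' Y := by
        rintro i j f X Y hX hK H h hc hfh _ - y' hy' hyy' ⟨y, hy, rfl⟩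
        have hcu := Finset.card_union_le f h
        obtain ⟨e, hfe, he, hec, g, hge, hgk, z, hz, hyz⟩ :=
          exists_sim_extend hE hSt hfh (by omega) (hX hy)
        refine ⟨z, (H g hgk (he.mono (Finset.union_subset
          (Finset.subset_union_left.trans hfe) hge)) y (hX hy) z hz hyz).1 hy, ?_⟩
        refine eq_of_sim hE hS he (by omega) (Υ.lift_mem_nodes hz) hy'
          (x := Level.lift t y) ?_ (hyy'.mono (Finset.subset_union_right.trans hfe))
        exact ((ih (he.mono hge) hgk (hX hy) hz).2 hyz).mono hge
      intro H h hc hfh y hy y' hy' hyy'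
      refine ⟨key hX hK H h hc hfh y hy y' hy' hyy', ?_⟩
      refine key hY (by rwa [card_inv]) H.inv (inv h) (by rwa [card_inv]) ?_ y' hy' y hy hyy'.inv
      rw [← inv_union]
      exact hfh.inv

/-- Images of old elements are old: some extension provides an image of `x` in `N_t`, and uniqueness
identifies its lift with `y`. Since members of sets in `V_{t+1}` are lifts, this makes `∈`
invariant. -/
lemma exists_eq_lift (hk : 8 * k ≤ K) (hS : ∀ s ≤ t, Supported A Υ k s) {f : Finset (A i × A j)}
    (hf : IsPartialIso L f) (hK : 2 * f.card + 8 * k ≤ K) {x : Level (A i) t}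
    {y : Level (A j) (t + 1)} (hx : x ∈ Υ.nodes (A i) t) (hy : y ∈ Υ.nodes (A j) (t + 1))
    (h : Υ.Sim k (t + 1) f (Level.lift t x) y) :
    ∃ x' ∈ Υ.nodes (A j) t, Level.lift t x' = y ∧
      ∃ g : Finset (A i × A j), g.card ≤ k ∧ IsPartialIso L (f ∪ g) ∧ Υ.Sim k t g x x' := by
  obtain ⟨e, hfe, he, hec, g, hge, hgk, x', hx', hxx'⟩ :=
    exists_sim_extend hE (hS t le_rfl) hf (by omega) hx
  refine ⟨x', hx', ?_, g, hgk, he.mono (Finset.union_subset hfe hge), hxx'⟩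
  refine eq_of_sim hE (fun s hs => hS s (by omega)) he (by omega) (Υ.lift_mem_nodes hx') hy
    (x := Level.lift t x) ?_ (h.mono hfe)
  exact (sim_lift hE hk (fun s hs => hS s hs.le) he (by omega) hx hx').2 (hxx'.mono hge)

lemma sim_mem_iff (hk : 8 * k ≤ K) (hS : ∀ s < t, Supported A Υ k s) {f : Finset (A i × A j)}
    (hf : IsPartialIso L f) (hK : 2 * f.card + 8 * k ≤ K) {x y : Level (A i) t}
    {x' y' : Level (A j) t} (hx : x ∈ Υ.nodes (A i) t) (hy : y ∈ Υ.nodes (A i) t)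
    (hx' : x' ∈ Υ.nodes (A j) t) (hy' : y' ∈ Υ.nodes (A j) t)
    (h : Υ.Sim k t f x x') (h' : Υ.Sim k t f y y') : Level.Mem t x y ↔ Level.Mem t x' y' := by
  have key : ∀ {i j : ι} {f : Finset (A i × A j)}, IsPartialIso L f → 2 * f.card + 8 * k ≤ K →
      ∀ {x y : Level (A i) t} {x' y' : Level (A j) t}, y ∈ Υ.nodes (A i) t →
      x' ∈ Υ.nodes (A j) t → Υ.Sim k t f x x' → Υ.Sim k t f y y' →
      Level.Mem t x y → Level.Mem t x' y' := by
    clear h h' hx hy hx' hy' x y x' y' hf hK f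
    intro i j f hf hK x y x' y' hy hx' h h' hm
    match t, x, y, x', y' with
    | 0, _, _, _, _ => exact hm
    | t + 1, _, Sum.inl _, _, _ => exact hm.elim
    | t + 1, _, Sum.inr _, _, Sum.inl _ => simp [Sim] at h'
    | t + 1, x, Sum.inr Y, x', Sum.inr Y' =>
      obtain ⟨z, hz, rfl⟩ := hm
      have hzn := Υ.subset_nodes hy hz
      obtain ⟨z', hz', rfl, g, hgk, hg, hzz'⟩ :=
        exists_eq_lift hE hk (fun s hs => hS s (by omega)) hf hK hzn hx' h
      exact ⟨z', (sim_inr.1 h' g hgk hg z hzn z' hz' hzz').1 hz, rfl⟩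
  exact ⟨key hf hK hy hx' h h', key hf.inv (by rwa [card_inv]) hy' hx h.inv h'.inv⟩

/-- To test `u` against `w`, interpolate: an extension of `f` to a support of `u` yields an image
`v`, and by recursion on the level `v` corresponds to `w` under the inverse of that map followed by
a map taking `u` to `w`. Two tests, from `u` to `v` and from `v` to `w`, give the result. The
condition `dom g ⊆ ran f` makes the second test map compatible with `g`. -/
lemma sim_comp (hk : 8 * k ≤ K) : ∀ {t : ℕ}, (∀ s < t, Supported A Υ k s) →
    ∀ {i j l : ι} {f : Finset (A i × A j)} {g : Finset (A j × A l)}, IsPartialIso L f →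
    IsPartialIso L g → dom g ⊆ ran f → 2 * f.card + 6 * k ≤ K →
    ∀ {x : Level (A i) t} {y : Level (A j) t} {z : Level (A l) t},
    Υ.Sim k t f x y → Υ.Sim k t g y z → Υ.Sim k t (comp f g) x z
  | 0, _, _, _, _, _, _, _, _, _, _, _, _, _, h, h' => by
    simp only [Sim] at h h' ⊢
    exact mem_comp.2 ⟨_, h, h'⟩
  | _ + 1, _, _, _, _, _, _, _, _, _, _, Sum.inl _, Sum.inl _, Sum.inl _, h, h' => by
    simp only [Sim] at h h' ⊢
    exact mem_comp.2 ⟨_, h, h'⟩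
  | _ + 1, _, _, _, _, _, _, _, _, _, _, Sum.inl _, Sum.inr _, _, h, _ => by simp [Sim] at h
  | _ + 1, _, _, _, _, _, _, _, _, _, _, Sum.inr _, Sum.inl _, _, h, _ => by simp [Sim] at h
  | _ + 1, _, _, _, _, _, _, _, _, _, _, _, Sum.inl _, Sum.inr _, _, h => by simp [Sim] at h
  | _ + 1, _, _, _, _, _, _, _, _, _, _, _, Sum.inr _, Sum.inl _, _, h => by simp [Sim] at h
  | t + 1, hS, i, j, l, f, g, hf, hg, hd, hK, Sum.inr X, Sum.inr Y, Sum.inr Z, hxy, hyz => by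
    rw [sim_inr] at hxy hyz ⊢
    intro h hhk hh u hu w hw huw
    have hS' : ∀ s < t, Supported A Υ k s := fun s hs => hS s (by omega)
    obtain ⟨S, hSk, hSu⟩ := hS t (Nat.lt_succ_self t) i u hu
    have hcu := Finset.card_union_le (comp f g) h
    have hcc := hf.card_comp_le hg
    obtain ⟨E, hhE, hE', hSE, hEc⟩ := hE i l _ hh S (by omega)
    obtain ⟨w', hw', huw'⟩ := hSu l E hE' hSE
    obtain rfl : w' = w := eq_of_sim hE hS' hE' (by omega) hw' hw (huw'.mono (res_subset _ _))
      (huw.mono (Finset.subset_union_right.trans hhE))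
    obtain ⟨F, hfF, hF, hSF, hFc⟩ := hE i j f hf S (by omega)
    obtain ⟨v, hv, huv⟩ := hSu j F hF hSF
    have hqk : (res F S).card ≤ k := (hF.card_res_le S).trans hSk
    have hpk : (res E S).card ≤ k := (hE'.card_res_le S).trans hSk
    have hq := hF.res S
    have hp := hE'.res S
    have hdq : dom (res F S) = S := subset_dom_res hSF
    have hdp : dom (res E S) = S := subset_dom_res hSE
    have hvw : Υ.Sim k t (comp (inv (res F S)) (res E S)) v w' :=
      sim_comp hk hS' hq.inv hp (by rw [ran_inv, hdq, hdp]) (by rw [card_inv]; omega) huv.inv huw'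
    refine (hxy _ hqk (hF.mono (Finset.union_subset hfF (res_subset _ _))) u hu v hv huv).trans
      (hyz _ ((hq.inv.card_comp_le hp).trans (by rwa [card_inv])) ?_ v hv w' hw' hvw)
    refine (hF.inv.comp hE').mono (Finset.union_subset ?_ ?_)
    · exact IsPartialIso.subset_comp_inv hfF (Finset.subset_union_left.trans hhE) hd
    · rintro ⟨b, c⟩ hbc
      obtain ⟨a, h1, h2⟩ := mem_comp.1 hbc
      exact mem_comp.2 ⟨a, mem_inv.2 (res_subset _ _ (mem_inv.1 h1)), res_subset _ _ h2⟩

lemma setSim_comp (hk : 8 * k ≤ K) (hS : ∀ s ≤ t, Supported A Υ k s) {f : Finset (A i × A j)}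
    {g : Finset (A j × A l)} (hf : IsPartialIso L f) (hg : IsPartialIso L g) (hd : dom g ⊆ ran f)
    (hK : 2 * f.card + 6 * k ≤ K) {X : Set (Level (A i) t)} {Y : Set (Level (A j) t)}
    {Z : Set (Level (A l) t)} (h : Υ.SetSim k t f X Y) (h' : Υ.SetSim k t g Y Z) :
    Υ.SetSim k t (comp f g) X Z :=
  sim_inr.1 (sim_comp hE hk (fun s hs => hS s (Nat.lt_succ_iff.1 hs)) hf hg hd hK (sim_inr.2 h)
    (sim_inr.2 h'))

end Family

end

end CPT

/-! ### Invariance of first order formulas, constants and halting. -/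

namespace CPT

open FirstOrder FirstOrder.Language FirstOrder.Language.Structure PMap Scheme

/-- The quantifier depth of a formula. -/
def quantifierDepth {L : FirstOrder.Language.{u, v}} {α : Type*} :
    {n : ℕ} → L.BoundedFormula α n → ℕ
  | _, .falsum => 0
  | _, .equal _ _ => 0
  | _, .rel _ _ => 0
  | _, .imp φ ψ => max (quantifierDepth φ) (quantifierDepth ψ)
  | _, .all φ => quantifierDepth φ + 1

open scoped Classical in
section

variable {L : FirstOrder.Language.{u, v}} [L.IsRelational]

section Pair

variable {Υ : Scheme L} {k : ℕ} {A B : Type w} [L.Structure A] [L.Structure B]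

lemma sim_atom_left : ∀ {t : ℕ} {f : Finset (A × B)} {a : A} {y : Level B t},
    Υ.Sim k t f (Level.atom t a) y ↔ ∃ b, y = Level.atom t b ∧ (a, b) ∈ f
  | 0, f, a, y => by simp [Sim, Level.atom]
  | t + 1, f, a, Sum.inl y => by simp [Sim, Level.atom]
  | t + 1, f, a, Sum.inr y => by simp [Sim, Level.atom]

lemma Sim.exists_relMap {t n : ℕ} {f : Finset (A × B)} (hf : IsPartialIso L f) (R : L.Relations n)
    {x : Fin n → Level A t} {y : Fin n → Level B t} (h : ∀ m, Υ.Sim k t f (x m) (y m)) :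
    (∃ a : Fin n → A, (∀ m, x m = Level.atom t (a m)) ∧ RelMap R a) →
    ∃ b : Fin n → B, (∀ m, y m = Level.atom t (b m)) ∧ RelMap R b := by
  rintro ⟨a, ha, hR⟩
  have h' : ∀ m, ∃ b, y m = Level.atom t b ∧ (a m, b) ∈ f := fun m =>
    sim_atom_left.1 (ha m ▸ h m)
  choose b hb hab using h'
  exact ⟨b, hb, (hf.rel_iff R (fun m => (a m, b m)) hab).1 hR⟩

end Pair

variable {ι : Type} {A : ι → Type w} [∀ i, L.Structure (A i)] {Υ : Scheme L} {k : ℕ}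
  {K : ℕ} (hE : HasExtensions L A K) (hk : 8 * k ≤ K) {t : ℕ} {i j l : ι}

include hE hk

/-- Back and forth: each quantifier adds a support of at most `k` points, hence `2 * k` to the size
bound. Invariance of the `𝒫_ℓ` is a hypothesis here, to be supplied by induction on the stage. -/
lemma realize_iff_of_pred (hS : ∀ s ≤ t, Supported A Υ k s)
    (hP : ∀ (ℓ : Fin Υ.m₁) (i j : ι) (f : Finset (A i × A j)), IsPartialIso L f →
      2 * f.card + 8 * k ≤ K → ∀ x ∈ Υ.nodes (A i) t, ∀ x' ∈ Υ.nodes (A j) t, Υ.Sim k t f x x' →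
      (x ∈ (Υ.stage (A i) t).pred ℓ ↔ x' ∈ (Υ.stage (A j) t).pred ℓ))
    {α : Type} {n : ℕ} (φ : (stageLang L Υ.m₁).BoundedFormula α n) :
    ∀ {i j : ι} {f : Finset (A i × A j)}, IsPartialIso L f →
    2 * f.card + quantifierDepth φ * (2 * k) + 8 * k ≤ K →
    ∀ {v : α → (Υ.stage (A i) t).carrier} {v' : α → (Υ.stage (A j) t).carrier}
      {xs : Fin n → (Υ.stage (A i) t).carrier} {xs' : Fin n → (Υ.stage (A j) t).carrier},
    (∀ a, Υ.Sim k t f (v a) (v' a)) → (∀ a, Υ.Sim k t f (xs a) (xs' a)) →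
    (φ.Realize v xs ↔ φ.Realize v' xs') := by
  have hterm : ∀ {n : ℕ} {i j : ι} {f : Finset (A i × A j)}
      {v : α → (Υ.stage (A i) t).carrier} {v' : α → (Υ.stage (A j) t).carrier}
      {xs : Fin n → (Υ.stage (A i) t).carrier} {xs' : Fin n → (Υ.stage (A j) t).carrier},
      (∀ a, Υ.Sim k t f (v a) (v' a)) → (∀ a, Υ.Sim k t f (xs a) (xs' a)) →
      ∀ τ : (stageLang L Υ.m₁).Term (α ⊕ Fin n),
      Υ.Sim k t f (τ.realize (Sum.elim v xs) : (Υ.stage (A i) t).carrier)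
        (τ.realize (Sum.elim v' xs') : (Υ.stage (A j) t).carrier) := by
    intro n i j f v v' xs xs' hv hxs τ
    match τ with
    | .var (Sum.inl a) => exact hv a
    | .var (Sum.inr a) => exact hxs a
    | .func F _ => exact F.elim (fun F => F.elim (fun F => isEmptyElim F) fun F => F.elim) fun F => F.elim
  induction φ with
  | falsum => intros; rfl
  | equal τ₁ τ₂ =>
    intro i j f hf hK v v' xs xs' hv hxs
    simp only [BoundedFormula.Realize]
    rw [Subtype.ext_iff, Subtype.ext_iff]
    exact sim_eq_iff hE (fun s hs => hS s hs.le) hf (by omega) (Subtype.coe_prop _)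
      (Subtype.coe_prop _) (Subtype.coe_prop _) (Subtype.coe_prop _) (hterm hv hxs τ₁) (hterm hv hxs τ₂)
  | rel R ts =>
    intro i j f hf hK v v' xs xs' hv hxs
    simp only [BoundedFormula.Realize]
    have hts := fun m => hterm hv hxs (ts m)
    rcases R with (R | R) | R
    · exact ⟨Sim.exists_relMap hf R hts, Sim.exists_relMap hf.inv R fun m => (hts m).inv⟩
    · cases R
      exact sim_mem_iff hE hk (fun s hs => hS s hs.le) hf (by omega) (Subtype.coe_prop _)
        (Subtype.coe_prop _) (Subtype.coe_prop _) (Subtype.coe_prop _) (hts 0) (hts 1)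
    · rcases R with ⟨ℓ⟩
      exact hP ℓ i j f hf (by omega) _ (Subtype.coe_prop _) _ (Subtype.coe_prop _) (hts 0)
  | imp φ ψ ih₁ ih₂ =>
    intro i j f hf hK v v' xs xs' hv hxs
    simp only [BoundedFormula.Realize]
    simp only [quantifierDepth] at hK
    have h1 := Nat.mul_le_mul_right (2 * k) (le_max_left (quantifierDepth φ) (quantifierDepth ψ))
    have h2 := Nat.mul_le_mul_right (2 * k) (le_max_right (quantifierDepth φ) (quantifierDepth ψ))
    rw [ih₁ hf (by omega) hv hxs, ih₂ hf (by omega) hv hxs]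
  | all φ ih =>
    have key : ∀ {i j : ι} {f : Finset (A i × A j)}, IsPartialIso L f →
        2 * f.card + quantifierDepth φ.all * (2 * k) + 8 * k ≤ K →
        ∀ {v : α → (Υ.stage (A i) t).carrier} {v' : α → (Υ.stage (A j) t).carrier}
          {xs : Fin _ → (Υ.stage (A i) t).carrier} {xs' : Fin _ → (Υ.stage (A j) t).carrier},
        (∀ a, Υ.Sim k t f (v a) (v' a)) → (∀ a, Υ.Sim k t f (xs a) (xs' a)) →
        φ.all.Realize v' xs' → φ.all.Realize v xs := by
      intro i j f hf hK v v' xs xs' hv hxs H x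
      simp only [quantifierDepth, Nat.add_mul, Nat.one_mul] at hK
      obtain ⟨e, hfe, he, hec, g, hge, -, x', hx', hxx'⟩ :=
        exists_sim_extend hE (hS t le_rfl) hf (by omega) x.2
      refine (ih he (by omega) (fun a => (hv a).mono hfe) (fun a => ?_)).2 (H ⟨x', hx'⟩)
      refine Fin.lastCases ?_ (fun a => ?_) a
      · simpa using hxx'.mono hge
      · simpa using (hxs a).mono hfe
    intro i j f hf hK v v' xs xs' hv hxs
    exact ⟨key hf.inv (by rwa [card_inv]) (fun a => (hv a).inv) (fun a => (hxs a).inv),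
      key hf hK hv hxs⟩

variable {d : ℕ} (hK : d * (2 * k) + 10 * k ≤ K)

include hK

/-- Invariance of `φ_ℓ` under every small test map is precisely this relation for the empty map. The
bound `10 * k` is `8 * k` plus `2 * k` for the test map. -/
lemma setSim_constant_of_pred (hS : ∀ s ≤ t, Supported A Υ k s)
    (hP : ∀ (ℓ : Fin Υ.m₁) (i j : ι) (f : Finset (A i × A j)), IsPartialIso L f →
      2 * f.card + 8 * k ≤ K → ∀ x ∈ Υ.nodes (A i) t, ∀ x' ∈ Υ.nodes (A j) t, Υ.Sim k t f x x' →
      (x ∈ (Υ.stage (A i) t).pred ℓ ↔ x' ∈ (Υ.stage (A j) t).pred ℓ))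
    (hd : ∀ ℓ, quantifierDepth (Υ.φ ℓ) ≤ d) (ℓ : Fin Υ.m₁) :
    Υ.SetSim k t (∅ : Finset (A i × A j)) (Υ.constant (Υ.stage (A i) t) ℓ)
      (Υ.constant (Υ.stage (A j) t) ℓ) := by
  intro h hhk hh y hy y' hy' hyy'
  rw [Finset.empty_union] at hh
  have hl := Nat.mul_le_mul_right (2 * k) (hd ℓ)
  have := realize_iff_of_pred hE hk hS hP (Υ.φ ℓ) hh (by omega)
    (v := fun _ => ⟨y, hy⟩) (v' := fun _ => ⟨y', hy'⟩) (xs := default) (xs' := default)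
    (fun _ => hyy') (fun a => a.elim0)
  constructor
  · rintro ⟨_, h1⟩
    exact ⟨hy', this.1 h1⟩
  · rintro ⟨_, h1⟩
    exact ⟨hy, this.2 h1⟩

/-- Induction on the stage: at stage `t + 1` the predicate holds only of `c_{t,ℓ}`, whose unique
image is the corresponding constant of the other structure. -/
lemma pred_iff (hd : ∀ ℓ, quantifierDepth (Υ.φ ℓ) ≤ d) :
    ∀ {t : ℕ}, (∀ s ≤ t, Supported A Υ k s) →
    ∀ (ℓ : Fin Υ.m₁) (i j : ι) (f : Finset (A i × A j)), IsPartialIso L f →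
      2 * f.card + 8 * k ≤ K → ∀ x ∈ Υ.nodes (A i) t, ∀ x' ∈ Υ.nodes (A j) t, Υ.Sim k t f x x' →
      (x ∈ (Υ.stage (A i) t).pred ℓ ↔ x' ∈ (Υ.stage (A j) t).pred ℓ)
  | 0, _, _, _, _, _, _, _, _, _, _, _, _ => Iff.rfl
  | t + 1, hS, ℓ, i, j, f, hf, hfK, x, hx, x', hx', hxx' => by
    have hS' : ∀ s ≤ t, Supported A Υ k s := fun s hs => hS s (by omega)
    have hc : ∀ {i j : ι} {f : Finset (A i × A j)},
        Υ.SetSim k t f (Υ.constant (Υ.stage (A i) t) ℓ) (Υ.constant (Υ.stage (A j) t) ℓ) :=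
      fun {i j f} => (setSim_constant_of_pred hE hk hK hS' (pred_iff hd hS') hd ℓ).mono
        (Finset.empty_subset f)
    have key : ∀ {i j : ι} {f : Finset (A i × A j)}, IsPartialIso L f → 2 * f.card + 8 * k ≤ K →
        ∀ {x : Level (A i) (t + 1)} {x' : Level (A j) (t + 1)}, x' ∈ Υ.nodes (A j) (t + 1) →
        Υ.Sim k (t + 1) f x x' → x = Level.ofSet (Υ.constant (Υ.stage (A i) t) ℓ) →
        x' = Level.ofSet (Υ.constant (Υ.stage (A j) t) ℓ) := by
      rintro i j f hf hfK _ (x' | X') hx' hxx' rfl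
      · simp [Level.ofSet, Sim] at hxx'
      · rw [eq_of_setSim hE (hS' t le_rfl) hf (by omega) (Υ.subset_nodes hx')
          (Υ.constant_subset_nodes ℓ) (sim_inr.1 hxx') hc]
        rfl
    exact ⟨key hf hfK hx' hxx', key hf.inv (by rwa [card_inv]) hx hxx'.inv⟩

lemma setSim_constant (hd : ∀ ℓ, quantifierDepth (Υ.φ ℓ) ≤ d)
    (hS : ∀ s ≤ t, Supported A Υ k s) (ℓ : Fin Υ.m₁) :
    Υ.SetSim k t (∅ : Finset (A i × A j)) (Υ.constant (Υ.stage (A i) t) ℓ)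
      (Υ.constant (Υ.stage (A j) t) ℓ) :=
  setSim_constant_of_pred hE hk hK hS (pred_iff hE hk hK hd hS) hd ℓ

/-- Halting at time `t` does not depend on the structure. -/
lemma Halts.transfer [IsEmpty (L.Relations 0)] (hd : ∀ ℓ, quantifierDepth (Υ.φ ℓ) ≤ d)
    (hS : ∀ s ≤ t, Supported A Υ k s) (h : Υ.Halts (A i) t) : Υ.Halts (A j) t := by
  have h0 := setSim_constant hE hk hK (i := i) (j := j) hd hS ⟨0, by have := Υ.two_le; omega⟩
  have h1 := setSim_constant hE hk hK (i := i) (j := j) hd hS ⟨1, by have := Υ.two_le; omega⟩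
  unfold Scheme.Halts at h ⊢
  -- Now both constants of `A j` are images of the same set under the empty map.
  rw [h] at h0
  exact eq_of_setSim hE (hS t le_rfl) IsPartialIso.empty (by simp; omega)
    (Υ.constant_subset_nodes _) (Υ.constant_subset_nodes _) h0 h1

lemma realize_sentence_iff [IsEmpty (L.Relations 0)] (hd : ∀ ℓ, quantifierDepth (Υ.φ ℓ) ≤ d)
    (hS : ∀ s ≤ t, Supported A Υ k s) (χ : (plusLang L).Sentence) (hχ : quantifierDepth
      ((LHom.sumInl : plusLang L →ᴸ stageLang L Υ.m₁).onSentence χ) ≤ d) (i j : ι) :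
    χ.Realize (Υ.stage (A i) t).carrier ↔ χ.Realize (Υ.stage (A j) t).carrier := by
  rw [← LHom.realize_onSentence (Υ.stage (A i) t).carrier
      (LHom.sumInl : plusLang L →ᴸ stageLang L Υ.m₁),
    ← LHom.realize_onSentence (Υ.stage (A j) t).carrier
      (LHom.sumInl : plusLang L →ᴸ stageLang L Υ.m₁)]
  have hl := Nat.mul_le_mul_right (2 * k) hχ
  exact realize_iff_of_pred hE hk hS (pred_iff hE hk hK hd hS) _ (f := (∅ : Finset (A i × A j)))
    IsPartialIso.empty (by simp; omega) (fun a => a.elim) (fun a => a.elim0)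

/-- The members of the families have supports, of a size which depends on the arity. -/
lemma exists_support_family (hd : ∀ ℓ, quantifierDepth (Υ.φ ℓ) ≤ d)
    (hd' : ∀ κ, quantifierDepth (Υ.ψ κ) ≤ d) (hS : ∀ s ≤ t, Supported A Υ k s) (κ : Fin Υ.m₀)
    (hκ : 2 * (Υ.arity κ * k) + d * (2 * k) + 10 * k ≤ K) {X : Set (Level (A i) t)}
    (hX : X ∈ Υ.family (Υ.stage (A i) t) κ) :
    ∃ S : Finset (A i), S.card ≤ Υ.arity κ * k ∧ ∀ j, ∀ f : Finset (A i × A j),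
      IsPartialIso L f → S ⊆ dom f →
      ∃ X' ∈ Υ.family (Υ.stage (A j) t) κ, Υ.SetSim k t (res f S) X X' := by
  obtain ⟨b, rfl⟩ := hX
  choose S hSk hS' using fun m => hS t le_rfl i (b m) (b m).2
  -- The supports of the parameters together support the set that they define.
  refine ⟨Finset.univ.biUnion S, ?_, ?_⟩
  · refine Finset.card_biUnion_le.trans ((Finset.sum_le_card_nsmul _ _ k fun m _ => hSk m).trans ?_)
    simp
  have hSc : (Finset.univ.biUnion S).card ≤ Υ.arity κ * k := by
    refine Finset.card_biUnion_le.trans ((Finset.sum_le_card_nsmul _ _ k fun m _ => hSk m).trans ?_)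
    simp
  intro j f hf hdom
  have hsub : ∀ m, S m ⊆ Finset.univ.biUnion S := fun m =>
    Finset.subset_biUnion_of_mem S (Finset.mem_univ m)
  choose b' hb' hbb' using fun m => hS' m j f hf ((hsub m).trans hdom)
  refine ⟨_, ⟨fun m => ⟨b' m, hb' m⟩, rfl⟩, ?_⟩
  have hfc := hf.card_res_le (Finset.univ.biUnion S)
  intro h hhk hh y hy y' hy' hyy'
  have hcu := Finset.card_union_le (res f (Finset.univ.biUnion S)) h
  have hl := Nat.mul_le_mul_right (2 * k) (hd' κ)
  have hle : ∀ m, res f (S m) ⊆ res f (Finset.univ.biUnion S) := fun m p hp =>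
    Finset.mem_filter.2 ⟨(Finset.mem_filter.1 hp).1, hsub m (Finset.mem_filter.1 hp).2⟩
  have := realize_iff_of_pred hE hk hS (pred_iff hE hk hK hd hS) (Υ.ψ κ) hh (by omega)
    (v := Sum.elim (fun _ => ⟨y, hy⟩) b) (v' := Sum.elim (fun _ => ⟨y', hy'⟩) fun m => ⟨b' m, hb' m⟩)
    (xs := default) (xs' := default)
    (by
      rintro (a | m)
      · exact hyy'.mono Finset.subset_union_right
      · exact (hbb' m).mono ((hle m).trans Finset.subset_union_left)) (fun a => a.elim0)
  constructor
  · rintro ⟨_, h1⟩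
    exact ⟨hy', this.1 h1⟩
  · rintro ⟨_, h1⟩
    exact ⟨hy, this.2 h1⟩

end

end CPT

/-! ### Shrinking supports in small families. -/

namespace CPT

open FirstOrder FirstOrder.Language FirstOrder.Language.Structure PMap Scheme

open scoped Classical in
section

variable {L : FirstOrder.Language.{u, v}} [L.IsRelational]
  {ι : Type} {A : ι → Type w} [∀ i, L.Structure (A i)]

variable (A) in
/-- `S` is a support of the set `X`, a member of the `κ`-th family at stage `t`. -/
def IsFamilySupport (Υ : Scheme L) (k t : ℕ) (κ : Fin Υ.m₀) {i : ι} (X : Set (Level (A i) t))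
    (S : Finset (A i)) : Prop :=
  ∀ j, ∀ f : Finset (A i × A j), IsPartialIso L f → S ⊆ dom f →
    ∃ X' ∈ Υ.family (Υ.stage (A j) t) κ, Υ.SetSim k t (res f S) X X'

variable {Υ : Scheme L} {k K c : ℕ} {P₀ P₁ : (Σ l, L.Relations l) → Prop} {r : ι → ℕ}
  {blk : ∀ i, A i → ℕ × ℕ} (hA : ∀ i, IsGeneric P₀ P₁ K (r i) (blk i)) (hr : ∀ i, 0 < r i)
  {t : ℕ} {i j : ι} {κ : Fin Υ.m₀}

include hA hr

omit [L.IsRelational] in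
lemma hasExtensions : HasExtensions L A K :=
  fun i j _ hg D hK => (hA i).exists_extend (hA j) (hr j) hg D hK

/-- If the images of `X` under `h` and `h'` coincide, then the images of `X` under `f₁` and `f₂`
coincide if `f₁` and `f₂` agree where `h` and `h'` do. -/
lemma image_eq_of_image_eq (hK : 6 * c + 8 * k ≤ K) (hS : ∀ s ≤ t, Supported A Υ k s)
    {X : Set (Level (A i) t)} {S : Finset (A i)} (hSc : S.card ≤ c)
    (hXS : IsFamilySupport A Υ k t κ X S)
    {h h' : Finset (A i × A i)} (hh : IsPartialIso L h) (hh' : IsPartialIso L h')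
    (hd : dom h = S) (hd' : dom h' = S) (hc : ∀ a b y, (a, y) ∈ h → (b, y) ∈ h' → a = b)
    {Y : Set (Level (A i) t)} (hY : Υ.SetSim k t h X Y) (hY' : Υ.SetSim k t h' X Y)
    {f₁ f₂ : Finset (A i × A j)} (hf₁ : IsPartialIso L f₁) (hf₂ : IsPartialIso L f₂)
    (hd₁ : dom f₁ = S) (hd₂ : dom f₂ = S) (hcf : ∀ a b y, (a, y) ∈ f₁ → (b, y) ∈ f₂ → a = b)
    (hT : ∀ a y, (a, y) ∈ h → (a, y) ∈ h' → ∃ z, (a, z) ∈ f₁ ∧ (a, z) ∈ f₂)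
    {X₁ X₂ : Set (Level (A j) t)} (hX₁ : X₁ ⊆ Υ.nodes (A j) t) (hX₂ : X₂ ⊆ Υ.nodes (A j) t)
    (h₁ : Υ.SetSim k t f₁ X X₁) (h₂ : Υ.SetSim k t f₂ X X₂) : X₁ = X₂ := by
  have hE := hasExtensions hA hr
  have hhc : (inv h).card ≤ c := by
    rw [card_inv]; exact (hh.card_le_card_dom.trans (hd ▸ le_rfl)).trans hSc
  have hhc' : (inv h').card ≤ c := by
    rw [card_inv]; exact (hh'.card_le_card_dom.trans (hd' ▸ le_rfl)).trans hSc
  have hG : ∀ f : Finset (A i × A j), dom (comp (inv h) f) ⊆ ran h := by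
    intro f x hx
    obtain ⟨y, hy⟩ := mem_dom.1 hx
    obtain ⟨a, ha, -⟩ := mem_comp.1 hy
    exact mem_ran.2 ⟨a, mem_inv.1 ha⟩
  have hc1 := hh.inv.card_comp_le hf₁
  have hc2 := hh.inv.card_comp_le hf₂
  have hDc : (ran h' \ ran h).card ≤ c :=
    (Finset.card_le_card Finset.sdiff_subset).trans ((card_ran_le h').trans (by rwa [card_inv] at hhc'))
  -- Both maps `h⁻¹; f₁` and `h⁻¹; f₂` are extended by the same `W` to the remaining points of `ran
  -- h'`, so that `F₁` and `F₂` agree on all of `ran h'`: on `ran h ∩ ran h'` they agree by `hc` and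
  -- `hT`.
  obtain ⟨W, hWc, hWd, hF₁, hF₂⟩ := (hA i).exists_union₂ (hA j) (hr j) (hh.inv.comp hf₁)
    (hh.inv.comp hf₂) (by
      intro x x' y hx hx'
      obtain ⟨a, ha, ha'⟩ := mem_comp.1 hx
      obtain ⟨b, hb, hb'⟩ := mem_comp.1 hx'
      obtain rfl := hcf a b y ha' hb'
      exact hh.snd_eq (mem_inv.1 ha) (mem_inv.1 hb)) (ran h' \ ran h)
    (Finset.disjoint_of_subset_right (hG f₁) Finset.sdiff_disjoint)
    (Finset.disjoint_of_subset_right (hG f₂) Finset.sdiff_disjoint) (by omega)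
  set F₁ := comp (inv h) f₁ ∪ W
  set F₂ := comp (inv h) f₂ ∪ W
  -- The image of `X` under this map is the image of `Y` under both `F₁` and `F₂`. As `Y` is also
  -- the image of `X` under `h`, these images are `X₁` and `X₂`.
  have hw : IsPartialIso L (comp h' (F₁ ∩ F₂)) := hh'.comp (hF₁.mono Finset.inter_subset_left)
  have hwd : S ⊆ dom (comp h' (F₁ ∩ F₂)) := by
    intro a ha
    obtain ⟨x, hx⟩ := mem_dom.1 (hd' ▸ ha)
    by_cases hxh : x ∈ ran h
    · obtain ⟨a', ha'⟩ := mem_ran.1 hxh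
      obtain rfl := hc _ _ _ ha' hx
      obtain ⟨z, hz₁, hz₂⟩ := hT a' x ha' hx
      exact mem_dom.2 ⟨z, mem_comp.2 ⟨x, hx, Finset.mem_inter.2
        ⟨Finset.mem_union_left _ (mem_comp.2 ⟨a', mem_inv.2 ha', hz₁⟩),
          Finset.mem_union_left _ (mem_comp.2 ⟨a', mem_inv.2 ha', hz₂⟩)⟩⟩⟩
    · obtain ⟨z, hz⟩ := mem_dom.1 (hWd (Finset.mem_sdiff.2 ⟨mem_ran.2 ⟨a, hx⟩, hxh⟩))
      exact mem_dom.2 ⟨z, mem_comp.2 ⟨x, hx, Finset.mem_inter.2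
        ⟨Finset.mem_union_right _ hz, Finset.mem_union_right _ hz⟩⟩⟩
  obtain ⟨Xw, hXw, hw'⟩ := hXS j _ hw hwd
  replace hw' := hw'.mono (res_subset _ _)
  have hYw : Υ.SetSim k t (comp (inv h') (comp h' (F₁ ∩ F₂))) Y Xw := by
    refine setSim_comp hE (by omega) hS hh'.inv hw ?_ (by omega) hY'.inv hw'
    intro a ha
    obtain ⟨y, hy⟩ := mem_dom.1 ha
    obtain ⟨x, hx, -⟩ := mem_comp.1 hy
    exact mem_ran.2 ⟨x, mem_inv.2 hx⟩
  have hsub : comp (inv h') (comp h' (F₁ ∩ F₂)) ⊆ F₁ ∩ F₂ := by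
    rintro ⟨x, y⟩ hxy
    obtain ⟨a, ha, hay⟩ := mem_comp.1 hxy
    obtain ⟨x', hx', hx'y⟩ := mem_comp.1 hay
    rwa [hh'.snd_eq (mem_inv.1 ha) hx']
  have hc3 : F₁.card ≤ _ := Finset.card_union_le (comp (inv h) f₁) W
  have hc4 : F₂.card ≤ _ := Finset.card_union_le (comp (inv h) f₂) W
  have hY₁ : Υ.SetSim k t F₁ Y X₁ :=
    (setSim_comp hE (by omega) hS hh.inv hf₁ (by rw [ran_inv, hd, hd₁]) (by omega) hY.inv h₁).mono
      Finset.subset_union_left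
  have hY₂ : Υ.SetSim k t F₂ Y X₂ :=
    (setSim_comp hE (by omega) hS hh.inv hf₂ (by rw [ran_inv, hd, hd₂]) (by omega) hY.inv h₂).mono
      Finset.subset_union_left
  have hXwn := Υ.subset_nodes_of_mem_family hXw
  rw [eq_of_setSim hE (hS t le_rfl) hF₁ (by omega) hX₁ hXwn hY₁
      (hYw.mono (hsub.trans Finset.inter_subset_left)),
    eq_of_setSim hE (hS t le_rfl) hF₂ (by omega) hX₂ hXwn hY₂
      (hYw.mono (hsub.trans Finset.inter_subset_right))]

/-- If the images of `X` under `h` and `h'` coincide, then `X` is supported by the set on which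
`h` and `h'` agree. -/
lemma isFamilySupport_of_image_eq (hK : 6 * c + 8 * k ≤ K) (hS : ∀ s ≤ t, Supported A Υ k s)
    {X : Set (Level (A i) t)} {S : Finset (A i)} (hSc : S.card ≤ c)
    (hXS : IsFamilySupport A Υ k t κ X S)
    {h h' : Finset (A i × A i)} (hh : IsPartialIso L h) (hh' : IsPartialIso L h')
    (hd : dom h = S) (hd' : dom h' = S) (hc : ∀ a b y, (a, y) ∈ h → (b, y) ∈ h' → a = b)
    {Y : Set (Level (A i) t)} (hY : Υ.SetSim k t h X Y) (hY' : Υ.SetSim k t h' X Y) :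
    IsFamilySupport A Υ k t κ X (dom (h ∩ h')) := by
  have hE := hasExtensions hA hr
  set T := dom (h ∩ h') with hT
  have hTS : T ⊆ S := hd ▸ dom_mono Finset.inter_subset_left
  have hTc := Finset.card_le_card hTS
  intro j f hf hTf
  have hfc := hf.card_res_le T
  obtain ⟨e₁, he₁, he₁', hSe₁, -⟩ := hE i j (res f T) (hf.res T) S (by omega)
  obtain ⟨X₁, hX₁, h₁⟩ := hXS j e₁ he₁' hSe₁
  have hres : ∀ e : Finset (A i × A j), res f T ⊆ e → res f T ⊆ res e S := by
    rintro e he ⟨a, y⟩ hay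
    exact mem_res.2 ⟨he hay, hTS (mem_res.1 hay).2⟩
  have key : ∀ e₂ : Finset (A i × A j), res f T ⊆ e₂ → IsPartialIso L e₂ → S ⊆ dom e₂ →
      ∀ X₂ ∈ Υ.family (Υ.stage (A j) t) κ, Υ.SetSim k t (res e₂ S) X X₂ → X₂ = X₁ := by
    intro e₂ he₂ he₂' hSe₂ X₂ hX₂ h₂
    have hr1 := card_ran_le (res e₁ S)
    have hr2 := card_ran_le (res e₂ S)
    have hr3 := he₁'.card_res_le S
    have hr4 := he₂'.card_res_le S
    have hr5 := Finset.card_union_le (ran (res e₁ S)) (ran (res e₂ S))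
    -- The maps `e₁` and `e₂` may send different points to the same value, so they are not compared
    -- directly but each with a map `e` whose new values avoid both ranges. Avoiding `2 * c` values
    -- accounts for the bound `6 * c`.
    obtain ⟨e, he, he', hSe, -, hav⟩ := (hA i).exists_extend_avoid (hA j) (hr j) (hf.res T) S
      (ran (res e₁ S) ∪ ran (res e₂ S)) (by omega)
    obtain ⟨X₀, hX₀, h₀⟩ := hXS j e he' hSe
    have aux : ∀ e' : Finset (A i × A j), res f T ⊆ e' → IsPartialIso L e' → S ⊆ dom e' →
        ran (res e' S) ⊆ ran (res e₁ S) ∪ ran (res e₂ S) →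
        ∀ X' ∈ Υ.family (Υ.stage (A j) t) κ, Υ.SetSim k t (res e' S) X X' → X₀ = X' := by
      intro e' hfe' hpe' hSe' hran X' hX' hs
      refine image_eq_of_image_eq hA hr hK hS hSc hXS hh hh' hd hd' hc hY hY' (he'.res S)
        (hpe'.res S) (subset_dom_res hSe) (subset_dom_res hSe') ?_ ?_
        (Υ.subset_nodes_of_mem_family hX₀) (Υ.subset_nodes_of_mem_family hX') h₀ hs
      · intro a b y ha hb
        by_cases hay : (a, y) ∈ res f T
        · exact (hpe'.res S).fst_eq (hres e' hfe' hay) hb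
        · exact absurd (hran (mem_ran.2 ⟨b, hb⟩)) (hav a y (mem_res.1 ha).1 hay)
      · intro a y ha ha'
        have haT : a ∈ T := mem_dom.2 ⟨y, Finset.mem_inter.2 ⟨ha, ha'⟩⟩
        obtain ⟨z, hz⟩ := mem_dom.1 (hTf haT)
        have hz' : (a, z) ∈ res f T := mem_res.2 ⟨hz, haT⟩
        exact ⟨z, hres e he hz', hres e' hfe' hz'⟩
    exact (aux e₂ he₂ he₂' hSe₂ Finset.subset_union_right X₂ hX₂ h₂).symm.trans
      (aux e₁ he₁ he₁' hSe₁ Finset.subset_union_left X₁ hX₁ h₁)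
  refine ⟨X₁, hX₁, ?_⟩
  -- Any test compatible with `res f T` becomes a test for an extension to `S`, and by `key` every
  -- such extension has the same image `X₁`.
  intro g hgk hg u hu w hw huw
  have hcu := Finset.card_union_le (res f T) g
  obtain ⟨e, hge, he, hSe, -⟩ := hE i j _ hg S (by omega)
  obtain ⟨X₂, hX₂, h₂⟩ := hXS j e he hSe
  obtain rfl := key e (Finset.subset_union_left.trans hge) he hSe X₂ hX₂ h₂
  exact h₂ g hgk (he.mono (Finset.union_subset (res_subset _ _)
    (Finset.subset_union_right.trans hge))) u hu w hw huw

/-- A member of a small family which has a support has a support with at most `k` elements. -/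
lemma exists_small_support [IsEmpty (L.Relations 0)] (hK : 6 * c + 8 * k ≤ K)
    (hS : ∀ s ≤ t, Supported A Υ k s)
    (hfam : (Υ.family (Υ.stage (A i) t) κ).encard < (r i ^ (k + 1) : ℕ))
    {X : Set (Level (A i) t)} {S : Finset (A i)} (hSc : S.card ≤ c)
    (hXS : IsFamilySupport A Υ k t κ X S) :
    ∃ S' : Finset (A i), S'.card ≤ k ∧ IsFamilySupport A Υ k t κ X S' := by
  induction hn : S.card using Nat.strong_induction_on generalizing S with
  | _ n ih =>
  subst hn
  by_cases hk : S.card ≤ k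
  · exact ⟨S, hk, hXS⟩
  suffices H : ∃ h h' : Finset (A i × A i), IsPartialIso L h ∧ IsPartialIso L h' ∧ dom h = S ∧
      dom h' = S ∧ (∀ a b y, (a, y) ∈ h → (b, y) ∈ h' → a = b) ∧ dom (h ∩ h') ≠ S ∧
      ∃ Y, Υ.SetSim k t h X Y ∧ Υ.SetSim k t h' X Y by
    obtain ⟨h, h', hh, hh', hd, hd', hc, hne, Y, hY, hY'⟩ := H
    have hlt := Finset.card_lt_card
      ((hd ▸ dom_mono Finset.inter_subset_left : dom (h ∩ h') ⊆ S).ssubset_of_ne hne)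
    exact ih _ hlt (by omega)
      (isFamilySupport_of_image_eq hA hr hK hS hSc hXS hh hh' hd hd' hc hY hY') rfl
  -- The first block coordinate records which point of `S` is embedded, so equal values of two
  -- embeddings have equal preimages; the second coordinate `J` is free.
  let I : A i → ℕ := fun a => if ha : a ∈ S then S.equivFin ⟨a, ha⟩ else 0
  have hI : ∀ a ∈ S, ∀ b ∈ S, I a = I b → a = b := by
    intro a ha b hb hab
    simp only [I, ha, hb, dif_pos] at hab
    have := S.equivFin.injective (Fin.ext hab)
    exact congrArg Subtype.val this
  have hemb : ∀ J : S → Fin (r i), ∃ e : Finset (A i × A i), IsPartialIso L e ∧ dom e = S ∧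
      ∀ x y, (x, y) ∈ e → ∃ hx : x ∈ S, blk i y = (I x, (J ⟨x, hx⟩ : ℕ)) := by
    intro J
    obtain ⟨e, he, hed, hb⟩ := (hA i).exists_embedding_blocks S (by omega) I
      (fun a => if ha : a ∈ S then J ⟨a, ha⟩ else 0)
      (by
        intro a ha
        simp only [I, ha, dif_pos]
        exact (Fin.is_lt _).trans_le (by omega))
      (by
        intro a ha
        simp only [ha, dif_pos]
        exact Fin.is_lt _)
    refine ⟨e, he, hed, fun x y hxy => ?_⟩
    have hx : x ∈ S := hed ▸ mem_dom.2 ⟨y, hxy⟩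
    exact ⟨hx, by simpa [hx] using hb x y hxy⟩
  choose e he hed hb using hemb
  choose Y hYf hY using fun J => hXS i (e J) (he J) (hed J).ge
  replace hY := fun J => (hY J).mono (res_subset _ _)
  -- Otherwise the family would have at least `r i ^ S.card`, hence at least `r i ^ (k + 1)`,
  -- members.
  have hninj : ¬ Function.Injective Y := by
    intro hinj
    have h1 : (Set.range Y).encard ≤ (Υ.family (Υ.stage (A i) t) κ).encard :=
      Set.encard_le_encard (Set.range_subset_iff.2 hYf)
    have h2 := (hinj.encard_range.trans h1).trans_lt hfam
    rw [ENat.card_eq_coe_fintype_card] at h2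
    simp only [Fintype.card_fun, Fintype.card_fin, Fintype.card_coe, Nat.cast_lt] at h2
    exact absurd (Nat.pow_le_pow_right (hr i) (by omega : k + 1 ≤ S.card)) (by omega)
  simp only [Function.Injective, not_forall] at hninj
  obtain ⟨J, J', hJ, hne⟩ := hninj
  refine ⟨e J, e J', he J, he J', hed J, hed J', ?_, ?_, Y J, hY J, hJ ▸ hY J'⟩
  · intro a b y ha hb'
    obtain ⟨ha', h1⟩ := hb J a y ha
    obtain ⟨hb'', h2⟩ := hb J' b y hb'
    rw [h1] at h2
    exact hI a ha' b hb'' (Prod.ext_iff.1 h2).1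
  · intro hdom
    apply hne
    funext a
    obtain ⟨y, hy⟩ := mem_dom.1 (hdom.ge a.2)
    obtain ⟨hy1, hy2⟩ := Finset.mem_inter.1 hy
    obtain ⟨_, h1⟩ := hb J _ y hy1
    obtain ⟨_, h2⟩ := hb J' _ y hy2
    rw [h1] at h2
    exact Fin.ext (Prod.ext_iff.1 h2).2

/-- As long as the families are small, all elements have supports with at most `k` elements. -/
lemma supported_of_encard_lt [IsEmpty (L.Relations 0)] {d q : ℕ} (hk : 0 < k)
    (hK : 6 * (q * k) + d * (2 * k) + 10 * k ≤ K) (hφ : ∀ ℓ, quantifierDepth (Υ.φ ℓ) ≤ d)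
    (hψ : ∀ κ, quantifierDepth (Υ.ψ κ) ≤ d) (hq : ∀ κ, Υ.arity κ ≤ q) {T : ℕ}
    (hfam : ∀ i, ∀ s < T, ∀ κ, (Υ.family (Υ.stage (A i) s) κ).encard < (r i ^ (k + 1) : ℕ)) :
    ∀ t ≤ T, Supported A Υ k t := by
  have hE := hasExtensions hA hr
  intro t
  induction t using Nat.strong_induction_on with
  | _ t ih =>
  intro hT
  rcases t with _ | t
  · intro i x hx
    refine ⟨{x}, by simpa using Nat.succ_le_of_lt hk, fun j f hf hxf => ?_⟩
    obtain ⟨y, hy⟩ := mem_dom.1 (hxf (Finset.mem_singleton_self x))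
    refine ⟨y, Set.mem_univ _, ?_⟩
    simp only [Sim]
    exact mem_res.2 ⟨hy, Finset.mem_singleton_self _⟩
  · have hS : ∀ s ≤ t, Supported A Υ k s := fun s hs => ih s (by omega) (by omega)
    intro i x hx
    rcases hx with ⟨x, hx, rfl⟩ | ⟨X, hX, rfl⟩
    · obtain ⟨S, hSk, hxS⟩ := hS t le_rfl i x hx
      refine ⟨S, hSk, fun j f hf hSf => ?_⟩
      obtain ⟨x', hx', hxx'⟩ := hxS j f hf hSf
      have := hf.card_res_le S
      exact ⟨_, Υ.lift_mem_nodes hx', (sim_lift hE (by omega) (fun s hs => hS s hs.le) (hf.res S)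
        (by omega) hx hx').2 hxx'⟩
    · obtain ⟨κ, hX⟩ := Set.mem_iUnion.1 hX
      have hm := Nat.mul_le_mul_right k (hq κ)
      -- The support given by the parameters may have up to `q * k` points; shrinking it back to `k`
      -- keeps the bound independent of the stage.
      obtain ⟨S₁, hS₁, hXS₁⟩ :=
        exists_support_family hE (by omega) (d := d) (by omega) hφ hψ hS κ (by omega) hX
      obtain ⟨S, hSk, hXS⟩ := exists_small_support hA hr (c := q * k) (by omega) hS
        (hfam i t (by omega) κ) (hS₁.trans hm) hXS₁
      refine ⟨S, hSk, fun j f hf hSf => ?_⟩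
      obtain ⟨X', hX', h⟩ := hXS j f hf hSf
      exact ⟨_, Υ.ofSet_mem_nodes hX', sim_inr.2 h⟩

end

end CPT

/-! ### Generic structures agree on defined truth values. -/

namespace CPT

open FirstOrder FirstOrder.Language FirstOrder.Language.Structure PMap Scheme

variable {L : FirstOrder.Language.{u, v}} [L.IsRelational]

lemma encard_family_le (Υ : Scheme L) {A : Type w} [L.Structure A] {t : ℕ} (S : Stage A Υ.m₁ t)
    [Finite S.carrier] (κ : Fin Υ.m₀) :
    (Υ.family S κ).encard ≤ (Nat.card S.carrier ^ Υ.arity κ : ℕ) := by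
  have := Fintype.ofFinite S.carrier
  let F : (Fin (Υ.arity κ) → S.carrier) → Set (Level A t) := fun b =>
    {a | ∃ ha : a ∈ S.carrier, (Υ.ψ κ).Realize (Sum.elim (fun _ => ⟨a, ha⟩) b)}
  have hF : Υ.family S κ ⊆ Set.range F := by
    rintro X ⟨b, rfl⟩
    exact ⟨b, rfl⟩
  refine (Set.encard_le_encard hF).trans ?_
  rw [← Set.image_univ]
  refine (Set.encard_image_le _ _).trans ?_
  rw [Set.encard_univ, ENat.card_eq_coe_fintype_card, Fintype.card_fun, Fintype.card_fin,
    Nat.card_eq_fintype_card]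

/-- The resource bound concerns only the families of stages `t + 1`; at stage 0 the arity provides
the bound instead. -/
lemma encard_family_zero_le (Υ : Scheme L) {A : Type w} [L.Structure A] [Finite A]
    (κ : Fin Υ.m₀) :
    (Υ.family (Υ.stage A 0) κ).encard ≤ (Nat.card A ^ Υ.arity κ : ℕ) := by
  let e : (Υ.stage A 0).carrier ≃ A := Equiv.Set.univ A
  have : Finite (Υ.stage A 0).carrier := Finite.of_equiv A e.symm
  rw [← Nat.card_congr e]
  exact encard_family_le Υ _ κ

lemma polyBound_le {q : ℚ} {Q n : ℕ} (hq : q ≤ Q) (hn : 0 < n) : polyBound q n ≤ n ^ Q := by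
  refine Nat.ceil_le.2 ?_
  push_cast
  rw [← Real.rpow_natCast]
  exact Real.rpow_le_rpow_of_exponent_le (by exact_mod_cast hn) (by exact_mod_cast hq)

/-- Generic structures agree on the truth value of `θ`, if it is defined. -/
lemma not_isTrue_and_isFalse [IsEmpty (L.Relations 0)] (θ : PolySentence L) {Q d k K : ℕ}
    (hk : 0 < k) (hK : 6 * (Q * k) + d * (2 * k) + 10 * k ≤ K)
    (hφ : ∀ ℓ, quantifierDepth (θ.scheme.φ ℓ) ≤ d) (hψ : ∀ κ, quantifierDepth (θ.scheme.ψ κ) ≤ d)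
    (hχ : quantifierDepth
      ((LHom.sumInl : plusLang L →ᴸ stageLang L θ.scheme.m₁).onSentence θ.χ) ≤ d)
    (har : ∀ κ, θ.scheme.arity κ ≤ Q) (hQ : θ.q ≤ Q)
    {ι : Type} {A : ι → Type w} [∀ i, L.Structure (A i)] [∀ i, Finite (A i)] [∀ i, Nonempty (A i)]
    {P₀ P₁ : (Σ l, L.Relations l) → Prop} {r : ι → ℕ} {blk : ∀ i, A i → ℕ × ℕ}
    (hA : ∀ i, IsGeneric P₀ P₁ K (r i) (blk i)) (hr : ∀ i, Nat.card (A i) ^ Q < r i ^ (k + 1))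
    (hdef : ∀ i, ¬ θ.IsUndefined (A i)) (i j : ι) : ¬ (θ.IsTrue (A i) ∧ θ.IsFalse (A j)) := by
  have hr0 : ∀ i, 0 < r i := by
    intro i
    rcases Nat.eq_zero_or_pos (r i) with h | h
    · have := hr i
      simp [h] at this
    · exact h
  simp only [PolySentence.IsUndefined, not_not] at hdef
  choose t ht using hdef
  have huniq : ∀ i s, θ.HaltsInTime (A i) s → s = t i := fun i s hs =>
    hs.1.unique (ht i).1
  -- The earliest stopping time: before it no structure has exceeded its resources, so all
  -- structures have small supports up to and including it.
  obtain ⟨T, ⟨i₀, rfl⟩, hT⟩ : ∃ T, T ∈ Set.range t ∧ ∀ i, T ≤ t i :=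
    ⟨sInf (Set.range t), Nat.sInf_mem ⟨t i, i, rfl⟩, fun j => Nat.sInf_le ⟨j, rfl⟩⟩
  have hfam : ∀ i, ∀ s < t i₀, ∀ κ,
      (θ.scheme.family (θ.scheme.stage (A i) s) κ).encard < (r i ^ (k + 1) : ℕ) := by
    intro i s hs κ
    have hpos : 0 < Nat.card (A i) := Nat.card_pos
    rcases s with _ | s
    · refine (encard_family_zero_le _ κ).trans_lt ?_
      exact_mod_cast (Nat.pow_le_pow_right hpos (har κ)).trans_lt (hr i)
    · have hnot : ¬ θ.scheme.Exceeds (A i) (polyBound θ.q (Nat.card (A i))) s := by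
        intro h
        have := (ht i).1.2 (Or.inr h)
        have := hT i
        omega
      simp only [Scheme.Exceeds, not_exists, not_lt] at hnot
      refine (hnot κ).trans_lt ?_
      exact_mod_cast (polyBound_le hQ hpos).trans_lt (hr i)
  have hE := hasExtensions (K := K) hA hr0
  have hS := supported_of_encard_lt hA hr0 hk hK hφ hψ har hfam
  -- Halting at the earliest stopping time transfers to every structure, so all stop there.
  have heq : ∀ i, t i = t i₀ := fun i =>
    le_antisymm ((ht i).1.2 (Or.inl (Halts.transfer hE (by omega) (d := d) (by omega) hφ hS
      (ht i₀).2))) (hT i)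
  rintro ⟨⟨s, hs, h1⟩, ⟨s', hs', h2⟩⟩
  obtain rfl := (huniq _ _ hs).trans (heq i)
  obtain rfl := (huniq _ _ hs').trans (heq j)
  exact h2 ((realize_sentence_iff hE (by omega) (by omega) hφ hS θ.χ hχ i j).1 h1)

end CPT

namespace CPT

open FirstOrder FirstOrder.Language FirstOrder.Language.Structure

/-! ### Random structures are generic -/

section Prob

open scoped Classical in
/-- The events that the coordinates in the pairwise disjoint sets `S b` have prescribed values are
independent. -/
lemma real_pi_iInter_compl {X β : Type*} [Fintype X] [Fintype β] (μ : X → Measure Bool)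
    [∀ x, IsProbabilityMeasure (μ x)] (S : β → Finset X) (hS : Pairwise fun b b' => Disjoint (S b) (S b'))
    (y : X → Bool) :
    (Measure.pi μ).real (⋂ b, {ω | ∀ x ∈ S b, ω x = y x}ᶜ) =
      ∏ b, (1 - ∏ x ∈ S b, (μ x).real {y x}) := by
  have hcyl : ∀ T : Finset X, (Measure.pi μ) {ω | ∀ x ∈ T, ω x = y x} = ∏ x ∈ T, μ x {y x} := by
    intro T
    rw [← Measure.pi_pi_finset]
    congr 1
  have hmeas : ∀ T : Finset X, MeasurableSet {ω : X → Bool | ∀ x ∈ T, ω x = y x} :=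
    fun T => (Set.toFinite _).measurableSet
  have hind : iIndepSet (fun b => {ω : X → Bool | ∀ x ∈ S b, ω x = y x}) (Measure.pi μ) := by
    rw [iIndepSet_iff_meas_biInter fun b => hmeas (S b)]
    intro s
    have : (⋂ b ∈ s, {ω : X → Bool | ∀ x ∈ S b, ω x = y x}) =
        {ω | ∀ x ∈ s.biUnion S, ω x = y x} := by
      ext ω
      simp only [Set.mem_iInter, Set.mem_ofPred_eq, Finset.mem_biUnion]
      exact ⟨fun h x ⟨b, hb, hx⟩ => h b hb x hx, fun h b hb x hx => h x ⟨b, hb, hx⟩⟩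
    rw [this, hcyl, Finset.prod_biUnion fun b _ b' _ h => hS h]
    exact Finset.prod_congr rfl fun b _ => (hcyl _).symm
  have := iIndep.meas_biInter hind (S := Finset.univ)
    (s := fun b => {ω : X → Bool | ∀ x ∈ S b, ω x = y x}ᶜ)
    (fun b _ => (MeasurableSpace.measurableSet_generateFrom (Set.mem_singleton _)).compl)
  simp only [Finset.mem_univ, Set.iInter_true] at this
  rw [measureReal_def, this, ENNReal.toReal_prod]
  refine Finset.prod_congr rfl fun b _ => ?_
  rw [← measureReal_def, probReal_compl_eq_one_sub (hmeas _), measureReal_def, hcyl,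
    ENNReal.toReal_prod]
  rfl

lemma real_bernoulli_true (q : unitInterval) :
    (bernoulliMeasure true false q).real {true} = q := by
  classical
  rw [bernoulliMeasure_real_apply _ (measurableSet_singleton _)]
  simp

lemma real_bernoulli_false (q : unitInterval) :
    (bernoulliMeasure true false q).real {false} = 1 - q := by
  classical
  rw [bernoulliMeasure_real_apply _ (measurableSet_singleton _)]
  simp

/-- Provides one lower bound for all positive values among `p R` and `1 - p R`; it is kept at most 1
so that its powers decrease. -/
lemma exists_pos_le {X : Type*} [Finite X] (f : X → ℝ) :
    ∃ ε : ℝ, 0 < ε ∧ ε ≤ 1 ∧ ∀ x, 0 < f x → ε ≤ f x := by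
  classical
  rcases isEmpty_or_nonempty X with _ | _
  · exact ⟨1, one_pos, le_rfl, fun x => isEmptyElim x⟩
  obtain ⟨x₀, hx₀⟩ := Finite.exists_min fun x => if 0 < f x then min (f x) 1 else 1
  refine ⟨_, ?_, ?_, fun x hx => (hx₀ x).trans ?_⟩
  · split_ifs with h
    · exact lt_min h one_pos
    · exact one_pos
  · split_ifs
    · exact min_le_right _ _
    · exact le_rfl
  · simp [hx]

end Prob

variable {L : FirstOrder.Language.{u, v}} [L.IsRelational]

/-- The block of an element of `{0, …, n - 1}`. -/
def block (K r : ℕ) {n : ℕ} (b : Fin n) : ℕ × ℕ := (b % K, b / K % r)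

/-- The atomic statements about `b` and the range of `c`. -/
noncomputable def atomsAt [Fintype (Σ l, L.Relations l)] {K n : ℕ} (c : Fin K ↪ Fin n)
    (b : Fin n) : Finset (Atomic L n) := by
  classical
  exact Finset.univ.filter fun x => (∃ m, x.2 m = b) ∧ ∀ m, x.2 m = b ∨ x.2 m ∈ Set.range c

/-- The value of an atomic statement which is prescribed by the type `τ` over the range of `c`. -/
noncomputable def typeValue {K n : ℕ} (c : Fin K ↪ Fin n)
    (τ : (Σ R : (Σ l, L.Relations l), (Fin R.1 → Option (Fin K))) → Bool) (x : Atomic L n) : Bool :=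
  τ ⟨x.1, fun m => Function.partialInv c (x.2 m)⟩

lemma partialInv_eq_none {α β : Type*} {f : α → β} {b : β} (h : b ∉ Set.range f) :
    Function.partialInv f b = none := by
  classical
  simp only [Function.partialInv]
  rw [dif_neg]
  exact h

variable [Fintype (Σ l, L.Relations l)] (p : (Σ l, L.Relations l) → unitInterval)

/-- Structures on `{0, …, n - 1}` in which the types over sets with exactly `K` elements are
realized are generic. -/
lemma isGeneric_of_forall {K r n : ℕ} (hKn : K ≤ n) (ω : Atomic L n → Bool)
    (h₀ : ∀ x : Atomic L n, (bernoulliMeasure true false (p x.1)).real {ω x} ≠ 0)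
    (h : ∀ c : Fin K ↪ Fin n,
      ∀ τ : (Σ R : (Σ l, L.Relations l), (Fin R.1 → Option (Fin K))) → Bool,
      (∀ y, (bernoulliMeasure true false (p y.1)).real {τ y} ≠ 0) → ∀ i < K, ∀ j < r,
      ∃ b ∉ Set.range c, block K r b = (i, j) ∧ ∀ x ∈ atomsAt c b, ω x = typeValue c τ x) :
    letI := modelOf ω
    IsGeneric (L := L) (fun R => p R = 0) (fun R => p R = 1) K r (block K r (n := n)) := by
  classical
  let := modelOf ω
  refine ⟨?_, ?_, ?_⟩
  · intro R hR x hx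
    refine h₀ ⟨R, x⟩ ?_
    rw [show ω ⟨R, x⟩ = true from hx, real_bernoulli_true]
    simp [hR]
  · intro R hR x
    by_contra hx
    refine h₀ ⟨R, x⟩ ?_
    rw [show ω ⟨R, x⟩ = false from Bool.eq_false_iff.2 hx, real_bernoulli_false]
    simp [hR]
  · intro C hC τ hτ₀ hτ₁ i hi j hj
    -- A type over fewer points is realized by realizing a type over exactly `K` points, which
    -- leaves only embeddings of `Fin K` to count.
    obtain ⟨C', hCC', hC'⟩ := Finset.exists_superset_card_eq hC (by simpa using hKn)
    let c : Fin K ↪ Fin n := (C'.orderEmbOfFin hC').toEmbedding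
    have hc : Set.range c = C' := C'.range_orderEmbOfFin hC'
    obtain ⟨b, hb, hblk, hω⟩ := h c (fun y => decide (τ y.1 fun m => (y.2 m).map c)) (by
      intro y
      by_cases hy : τ y.1 fun m => (y.2 m).map c
      · rw [decide_eq_true hy, real_bernoulli_true]
        intro h0
        exact hτ₀ y.1 (Subtype.ext h0) _ hy
      · rw [decide_eq_false hy, real_bernoulli_false]
        intro h0
        exact hy (hτ₁ y.1 (Subtype.ext (by simpa using (sub_eq_zero.1 h0).symm)) _)) i hi j hj
    refine ⟨b, fun hbC => hb (hc ▸ hCC' hbC), hblk, ?_⟩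
    intro R z hz hn
    have hzc : ∀ m, ∀ y, z m = some y → y ∈ Set.range c := fun m y hy =>
      hc ▸ hCC' (hz m y (by simp [hy]))
    have hx := hω ⟨R, fun m => (z m).getD b⟩ (by
      simp only [atomsAt, Finset.mem_filter, Finset.mem_univ, true_and]
      refine ⟨hn.imp fun m hm => by simp [hm], fun m => ?_⟩
      rcases hm : z m with _ | y
      · exact Or.inl rfl
      · exact Or.inr (hzc m y hm))
    have hz' : (fun m => (Function.partialInv c ((z m).getD b)).map c) = z := by
      funext m
      rcases hm : z m with _ | y
      · rw [Option.getD_none, partialInv_eq_none hb]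
        rfl
      · obtain ⟨a, rfl⟩ := hzc m y hm
        rw [Option.getD_some, Function.partialInv_left c.injective]
        rfl
    change ω ⟨R, fun m => (z m).getD b⟩ = true ↔ _
    rw [hx]
    simp only [typeValue, decide_eq_true_eq]
    rw [hz']

omit [L.IsRelational] in
-- Each argument is `b` or a point of the range of `c`, hence is recorded by an element of `Option
-- (Fin K)`; the bound does not depend on `n`.
lemma card_atomsAt_le {K n : ℕ} (c : Fin K ↪ Fin n) (b : Fin n) :
    (atomsAt (L := L) c b).card ≤
      Fintype.card (Σ R : (Σ l, L.Relations l), (Fin R.1 → Option (Fin K))) := by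
  classical
  rw [← Finset.card_univ]
  refine Finset.card_le_card_of_injOn
    (fun x => ⟨x.1, fun m => Function.partialInv c (x.2 m)⟩) (fun _ _ => Finset.mem_univ _) ?_
  rintro ⟨R, x⟩ hx ⟨R', x'⟩ hx' h
  simp only [Sigma.mk.injEq] at h
  obtain ⟨rfl, h⟩ := h
  simp only [atomsAt, Finset.coe_filter, Finset.mem_univ, true_and, Set.mem_ofPred_eq] at hx hx'
  have h := fun m => congrFun (eq_of_heq h) m
  congr 1
  funext m
  by_cases h1 : x m ∈ Set.range c <;> by_cases h2 : x' m ∈ Set.range c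
  · obtain ⟨a, ha⟩ := h1
    obtain ⟨a', ha'⟩ := h2
    have := h m
    rw [← ha, ← ha', Function.partialInv_left c.injective,
      Function.partialInv_left c.injective, Option.some_inj] at this
    rw [← ha, ← ha', this]
  · obtain ⟨a, ha⟩ := h1
    have := h m
    rw [← ha, Function.partialInv_left c.injective, partialInv_eq_none h2] at this
    simp at this
  · obtain ⟨a, ha⟩ := h2
    have := h m
    rw [← ha, Function.partialInv_left c.injective, partialInv_eq_none h1] at this
    simp at this
  · rw [(hx.2 m).resolve_right h1, (hx'.2 m).resolve_right h2]

omit [L.IsRelational] in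
-- A statement about `b` mentions `b`, which is neither `b'` nor in the range of `c`. Thus different
-- candidates for a witness are independent.
lemma disjoint_atomsAt {K n : ℕ} (c : Fin K ↪ Fin n) {b b' : Fin n} (hb : b ∉ Set.range c)
    (hne : b ≠ b') : Disjoint (atomsAt (L := L) c b) (atomsAt c b') := by
  classical
  rw [Finset.disjoint_left]
  intro x hx hx'
  simp only [atomsAt, Finset.mem_filter, Finset.mem_univ, true_and] at hx hx'
  obtain ⟨m, rfl⟩ := hx.1
  exact (hx'.2 m).elim hne hb

/-- The points `i + K * (j + r * l)` with `l < r` lie in the block, and the range of `c` removes at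
most `K` of them. -/
lemma le_card_block {K r n : ℕ} (hn : K * r * r ≤ n) (c : Fin K ↪ Fin n) {i j : ℕ} (hi : i < K)
    (hj : j < r) :
    r - K ≤ Fintype.card {b : Fin n // b ∉ Set.range c ∧ block K r b = (i, j)} := by
  classical
  have hlt : ∀ l : Fin r, i + K * (j + r * l) < n := by
    intro l
    refine lt_of_lt_of_le ?_ hn
    have h1 : j + r * l < r * r := by
      have := Nat.mul_le_mul_left r (Nat.succ_le_of_lt l.2)
      rw [Nat.mul_succ] at this
      omega
    have h2 := Nat.mul_le_mul_left K (Nat.succ_le_of_lt h1)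
    rw [Nat.mul_succ, ← Nat.mul_assoc] at h2
    omega
  let e : Fin r → Fin n := fun l => ⟨i + K * (j + r * l), hlt l⟩
  have he : Function.Injective e := by
    intro l l' h
    have h1 : i + K * (j + r * l) = i + K * (j + r * l') := congrArg Fin.val h
    have h2 := Nat.eq_of_mul_eq_mul_left (by omega) (Nat.add_left_cancel h1)
    exact Fin.ext (Nat.eq_of_mul_eq_mul_left (by omega) (Nat.add_left_cancel h2))
  have hblk : ∀ l, block K r (e l) = (i, j) := by
    intro l
    simp only [block, e]
    rw [Nat.add_mul_mod_self_left, Nat.mod_eq_of_lt hi, Nat.add_mul_div_left _ _ (by omega),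
      Nat.div_eq_of_lt hi, Nat.zero_add, Nat.add_mul_mod_self_left, Nat.mod_eq_of_lt hj]
  rw [Fintype.card_subtype]
  have h1 : (Finset.univ.image e) \ (Finset.univ.image c) ⊆
      Finset.univ.filter fun b => b ∉ Set.range c ∧ block K r b = (i, j) := by
    intro b hb
    simp only [Finset.mem_sdiff, Finset.mem_image, Finset.mem_univ, true_and] at hb
    obtain ⟨⟨l, rfl⟩, hb⟩ := hb
    simp only [Finset.mem_filter, Finset.mem_univ, true_and]
    exact ⟨fun ⟨a, ha⟩ => hb ⟨a, ha⟩, hblk l⟩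
  refine le_trans ?_ (Finset.card_le_card h1)
  refine le_trans ?_ (Finset.le_card_sdiff _ _)
  rw [Finset.card_image_of_injective _ he, Finset.card_image_of_injective _ c.injective]
  simp

instance (n : ℕ) : IsProbabilityMeasure (randomModel L p n) := by
  unfold randomModel; infer_instance

omit [L.IsRelational] in
-- This takes care of predicates with probability 0 or 1, which must be empty or full in a generic
-- structure.
lemma real_null_eq_zero {n : ℕ} (x : Atomic L n) :
    (randomModel L p n).real {ω | (bernoulliMeasure true false (p x.1)).real {ω x} = 0} = 0 := by
  classical
  have h1 : (randomModel L p n).map (Function.eval x) = bernoulliMeasure true false (p x.1) :=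
    (measurePreserving_eval (fun x : Atomic L n => bernoulliMeasure true false (p x.1)) x).map_eq
  have h2 : {ω : Atomic L n → Bool | (bernoulliMeasure true false (p x.1)).real {ω x} = 0} =
      Function.eval x ⁻¹' {v : Bool | (bernoulliMeasure true false (p x.1)).real {v} = 0} := rfl
  rw [h2, ← map_measureReal_apply (measurable_pi_apply x) (Set.toFinite _).measurableSet, h1]
  rw [← Set.biUnion_of_singleton {v : Bool | (bernoulliMeasure true false (p x.1)).real {v} = 0}]
  refine le_antisymm ?_ measureReal_nonneg
  have h3 := measureReal_biUnion_finset_le (μ := bernoulliMeasure true false (p x.1))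
    (Set.toFinite {v : Bool | (bernoulliMeasure true false (p x.1)).real {v} = 0}).toFinset
    (fun v : Bool => ({v} : Set Bool))
  simp only [Set.Finite.mem_toFinset] at h3
  refine h3.trans (le_of_eq (Finset.sum_eq_zero fun v hv => ?_))
  simpa using hv

omit [L.IsRelational] in
/-- The probability that a given type is not realized in a given block. -/
lemma real_forall_not_le {ε : ℝ} (hε0 : 0 < ε) (hε1 : ε ≤ 1) {K r n N : ℕ}
    (hN : Fintype.card (Σ R : (Σ l, L.Relations l), (Fin R.1 → Option (Fin K))) = N)
    (c : Fin K ↪ Fin n)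
    (τ : (Σ R : (Σ l, L.Relations l), (Fin R.1 → Option (Fin K))) → Bool)
    (hτ : ∀ y, ε ≤ (bernoulliMeasure true false (p y.1)).real {τ y}) (hn : K * r * r ≤ n) {i j : ℕ}
    (hi : i < K) (hj : j < r) :
    (randomModel L p n).real {ω : Atomic L n → Bool | ∀ b ∉ Set.range c, block K r b = (i, j) →
      ¬ ∀ x ∈ atomsAt c b, ω x = typeValue c τ x} ≤ (1 - ε ^ N / 2) ^ (r - K) := by
  classical
  have hη0 : 0 < ε ^ N := pow_pos hε0 _
  have hη1 : ε ^ N ≤ 1 := pow_le_one₀ hε0.le hε1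
  let β := {b : Fin n // b ∉ Set.range c ∧ block K r b = (i, j)}
  have h1 : {ω : Atomic L n → Bool | ∀ b ∉ Set.range c, block K r b = (i, j) →
      ¬ ∀ x ∈ atomsAt c b, ω x = typeValue c τ x} ⊆
      ⋂ b : β, {ω | ∀ x ∈ atomsAt c b.1, ω x = typeValue c τ x}ᶜ := by
    intro ω hω
    exact Set.mem_iInter.2 fun b => hω b.1 b.2.1 b.2.2
  refine (measureReal_mono h1).trans ?_
  unfold randomModel
  rw [real_pi_iInter_compl (β := β) _ (fun b => atomsAt c b.1)
    (fun b b' hne => disjoint_atomsAt c b.2.1 fun h => hne (Subtype.ext h))]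
  have h2 : ∀ b : β, 1 - ∏ x ∈ atomsAt c b.1,
      (bernoulliMeasure true false (p x.1)).real {typeValue c τ x} ≤ 1 - ε ^ N / 2 := by
    intro b
    have h3 : ε ^ (atomsAt (L := L) c b.1).card ≤ ∏ x ∈ atomsAt c b.1,
        (bernoulliMeasure true false (p x.1)).real {typeValue c τ x} := by
      rw [← Finset.prod_const]
      exact Finset.prod_le_prod (fun _ _ => hε0.le) fun x _ =>
        hτ ⟨x.1, fun m => Function.partialInv c (x.2 m)⟩
    have h4 : ε ^ N ≤ ε ^ (atomsAt (L := L) c b.1).card :=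
      pow_le_pow_of_le_one hε0.le hε1 ((card_atomsAt_le c b.1).trans hN.le)
    linarith
  refine (Finset.prod_le_prod (fun b _ => ?_) fun b _ => h2 b).trans ?_
  · exact sub_nonneg.2 (Finset.prod_le_one (fun _ _ => measureReal_nonneg)
      fun _ _ => measureReal_le_one)
  · rw [Finset.prod_const]
    exact pow_le_pow_of_le_one (by linarith) (by linarith) (le_card_block hn c hi hj)

/-- The probability that a structure is not generic. -/
lemma exists_real_not_isGeneric_le (K : ℕ) : ∃ δ : ℝ, 0 < δ ∧ δ < 1 ∧ ∃ N : ℕ,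
    ∀ r n : ℕ, K ≤ n → K * r * r ≤ n →
    (randomModel L p n).real {ω | ¬ letI := modelOf ω; IsGeneric (L := L) (fun R => p R = 0)
      (fun R => p R = 1) K r (block K r (n := n))} ≤ (n ^ K * N * K * r : ℕ) * δ ^ (r - K) := by
  classical
  obtain ⟨ε, hε0, hε1, hε⟩ := exists_pos_le fun x : (Σ l, L.Relations l) × Bool =>
    (bernoulliMeasure true false (p x.1)).real {x.2}
  let I := Σ R : (Σ l, L.Relations l), (Fin R.1 → Option (Fin K))
  obtain ⟨N, hN⟩ : ∃ N, Fintype.card I = N := ⟨_, rfl⟩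
  have hη0 : 0 < ε ^ N := pow_pos hε0 _
  have hη1 : ε ^ N ≤ 1 := pow_le_one₀ hε0.le hε1
  -- Halving keeps the base positive even if `ε = 1`; later `δ ^ K` is divided out.
  refine ⟨1 - ε ^ N / 2, by linarith, by linarith, Fintype.card (I → Bool), ?_⟩
  intro r n hKn hn
  let Θ := (Fin K ↪ Fin n) × (I → Bool) × Fin K × Fin r
  let bad : Θ → Set (Atomic L n → Bool) := fun θ =>
    {ω | (∀ y, (bernoulliMeasure true false (p y.1)).real {θ.2.1 y} ≠ 0) ∧
      ∀ b ∉ Set.range θ.1, block K r b = (↑θ.2.2.1, ↑θ.2.2.2) →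
      ¬ ∀ x ∈ atomsAt θ.1 b, ω x = typeValue θ.1 θ.2.1 x}
  let null : Atomic L n → Set (Atomic L n → Bool) := fun x =>
    {ω | (bernoulliMeasure true false (p x.1)).real {ω x} = 0}
  have hsub : {ω | ¬ letI := modelOf ω; IsGeneric (L := L) (fun R => p R = 0)
      (fun R => p R = 1) K r (block K r (n := n))} ⊆ (⋃ x, null x) ∪ ⋃ θ, bad θ := by
    intro ω hω
    by_contra hcon
    simp only [Set.mem_union, Set.mem_iUnion, not_or, not_exists] at hcon
    refine hω (isGeneric_of_forall p hKn ω (fun x => hcon.1 x) ?_)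
    intro c τ hτ i hi j hj
    by_contra hb
    push Not at hb
    refine hcon.2 (c, τ, ⟨i, hi⟩, ⟨j, hj⟩) ⟨hτ, fun b hbc hblk h => ?_⟩
    obtain ⟨x, hx, hne⟩ := hb b hbc hblk
    exact hne (h x hx)
  have hbad : ∀ θ, (randomModel L p n).real (bad θ) ≤ (1 - ε ^ N / 2) ^ (r - K) := by
    rintro ⟨c, τ, i, j⟩
    by_cases hτ : ∀ y, (bernoulliMeasure true false (p y.1)).real {τ y} ≠ 0
    · refine (measureReal_mono fun ω hω => ?_).trans (real_forall_not_le p hε0 hε1 hN c τ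
        (fun y => hε (y.1, τ y) (lt_of_le_of_ne measureReal_nonneg (hτ y).symm)) hn i.2 j.2)
      exact hω.2
    · have : bad (c, τ, i, j) = ∅ := Set.eq_empty_iff_forall_notMem.2 fun ω hω => hτ hω.1
      rw [this, measureReal_empty]
      exact pow_nonneg (by linarith) _
  have hΘ : Fintype.card Θ ≤ n ^ K * Fintype.card (I → Bool) * K * r := by
    simp only [Θ, Fintype.card_prod, Fintype.card_embedding_eq, Fintype.card_fin]
    rw [Nat.mul_assoc, Nat.mul_assoc]
    exact Nat.mul_le_mul_right _ (Nat.descFactorial_le_pow _ _)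
  calc _ ≤ (randomModel L p n).real ((⋃ x, null x) ∪ ⋃ θ, bad θ) := measureReal_mono hsub
    _ ≤ (randomModel L p n).real (⋃ x, null x) + (randomModel L p n).real (⋃ θ, bad θ) :=
      measureReal_union_le _ _
    _ ≤ ∑ x, (randomModel L p n).real (null x) + ∑ θ, (randomModel L p n).real (bad θ) :=
      add_le_add (measureReal_iUnion_fintype_le _) (measureReal_iUnion_fintype_le _)
    _ ≤ 0 + ∑ θ : Θ, (1 - ε ^ N / 2) ^ (r - K) :=
      add_le_add (Finset.sum_eq_zero fun x _ => real_null_eq_zero p x).le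
        (Finset.sum_le_sum fun θ _ => hbad θ)
    _ ≤ _ := by
      rw [zero_add, Finset.sum_const, nsmul_eq_mul, Finset.card_univ]
      exact mul_le_mul_of_nonneg_right (Nat.cast_le.2 hΘ) (pow_nonneg (by linarith) _)

/-- The random structure is almost surely generic. -/
lemma tendsto_real_not_isGeneric {K : ℕ} (hK : 0 < K) :
    Tendsto (fun n => (randomModel L p n).real {ω | ¬ letI := modelOf ω;
      IsGeneric (L := L) (fun R => p R = 0) (fun R => p R = 1) K (Nat.sqrt (n / K))
        (block K (Nat.sqrt (n / K)) (n := n))}) atTop (𝓝 0) := by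
  obtain ⟨δ, hδ0, hδ1, N, h⟩ := exists_real_not_isGeneric_le p K
  have hr : Tendsto (fun n => Nat.sqrt (n / K)) atTop atTop := by
    refine tendsto_atTop.2 fun b => ?_
    filter_upwards [eventually_ge_atTop (b * b * K)] with n hn
    exact Nat.le_sqrt.2 ((Nat.le_div_iff_mul_le hK).2 hn)
  -- Since `n ≤ 4 * K * r ^ 2`, the union bound is at most a constant times `r ^ (2 * K + 1) * δ ^
  -- r`.
  have hlim : Tendsto (fun r : ℕ => ((4 * K) ^ K * N * K : ℝ) * δ⁻¹ ^ K *
      ((r : ℝ) ^ (2 * K + 1) * δ ^ r)) atTop (𝓝 0) := by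
    have := (tendsto_pow_const_mul_const_pow_of_abs_lt_one (2 * K + 1) (r := δ)
      (by rwa [abs_of_pos hδ0])).const_mul (((4 * K) ^ K * N * K : ℝ) * δ⁻¹ ^ K)
    rwa [mul_zero] at this
  refine squeeze_zero' (Eventually.of_forall fun n => measureReal_nonneg) ?_ (hlim.comp hr)
  filter_upwards [eventually_ge_atTop K, hr.eventually_ge_atTop (K + 1)] with n hn hrn
  have hsq := Nat.sqrt_le (n / K)
  have hlt := Nat.lt_succ_sqrt (n / K)
  simp only [Function.comp]
  set r := Nat.sqrt (n / K)
  have h1 : K * r * r ≤ n := by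
    rw [Nat.mul_assoc, Nat.mul_comm]
    exact (Nat.le_div_iff_mul_le hK).1 hsq
  have h2 : n ≤ 4 * K * r ^ 2 := by
    have h3 := (Nat.div_lt_iff_lt_mul hK).1 hlt
    have h4 : r + 1 ≤ 2 * r := by omega
    have h5 := Nat.mul_le_mul h4 h4
    have h6 := Nat.mul_le_mul_right K h5
    calc n ≤ (r + 1) * (r + 1) * K := h3.le
      _ ≤ 2 * r * (2 * r) * K := h6
      _ = 4 * K * r ^ 2 := by ring
  refine (h r n hn h1).trans ?_
  have h7 : δ ^ (r - K) = δ⁻¹ ^ K * δ ^ r := by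
    rw [pow_sub₀ _ hδ0.ne' (by omega), inv_pow, mul_comm]
  have h8 : n ^ K * N * K * r ≤ (4 * K) ^ K * N * K * r ^ (2 * K + 1) := by
    calc n ^ K * N * K * r ≤ (4 * K * r ^ 2) ^ K * N * K * r := by gcongr
      _ = (4 * K) ^ K * N * K * r ^ (2 * K + 1) := by ring
  rw [h7]
  calc ((n ^ K * N * K * r : ℕ) : ℝ) * (δ⁻¹ ^ K * δ ^ r)
      ≤ (((4 * K) ^ K * N * K * r ^ (2 * K + 1) : ℕ) : ℝ) * (δ⁻¹ ^ K * δ ^ r) := by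
        gcongr
    _ = _ := by push_cast; ring

end CPT

/-! ### The 0-1 law. -/

namespace CPT

open FirstOrder FirstOrder.Language FirstOrder.Language.Structure

variable {L : FirstOrder.Language.{u, v}} [L.IsRelational] [Fintype (Σ l, L.Relations l)]
  (p : (Σ l, L.Relations l) → unitInterval) (θ : PolySentence L)

/-- From `n ≤ 4 * K * r ^ 2` follows `n ^ Q ≤ (4 * K) ^ Q * r ^ (2 * Q)`, and for large `n` one more
factor `r` absorbs the constant. -/
lemma pow_lt_sqrt_pow {K Q n : ℕ} (hK : 0 < K) (hn : (4 * K) ^ Q < Nat.sqrt (n / K)) :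
    n ^ Q < Nat.sqrt (n / K) ^ (2 * Q + 1 + 1) := by
  have hlt := Nat.lt_succ_sqrt (n / K)
  set r := Nat.sqrt (n / K)
  have h4 : r + 1 ≤ 2 * r := by omega
  have h2 : n ≤ 4 * K * r ^ 2 := by
    calc n ≤ (r + 1) * (r + 1) * K := ((Nat.div_lt_iff_lt_mul hK).1 hlt).le
      _ ≤ 2 * r * (2 * r) * K := Nat.mul_le_mul_right K (Nat.mul_le_mul h4 h4)
      _ = 4 * K * r ^ 2 := by ring
  have hr : 0 < r := by omega
  calc n ^ Q ≤ (4 * K * r ^ 2) ^ Q := Nat.pow_le_pow_left h2 Q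
    _ = (4 * K) ^ Q * r ^ (2 * Q) := by rw [mul_pow, ← pow_mul]
    _ < r * r ^ (2 * Q) := Nat.mul_lt_mul_of_pos_right hn (pow_pos hr _)
    _ = r ^ (2 * Q + 1) := by ring
    _ ≤ r ^ (2 * Q + 1 + 1) := Nat.pow_le_pow_right hr (Nat.le_succ _)

/-- Almost surely, the random structures of different sizes agree on the truth value of `θ`, if
it is defined. -/
lemma exists_isGeneric_agree [IsEmpty (L.Relations 0)] :
    ∃ good : ∀ n, Set (Atomic L n → Bool),
      Tendsto (fun n => (randomModel L p n).real (good n)ᶜ) atTop (𝓝 0) ∧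
      ∀ᶠ N in atTop, ∀ n ≥ N, ∀ n' ≥ N, ∀ ω ∈ good n, ∀ ω' ∈ good n',
        ¬ ((letI := modelOf ω; θ.IsTrue (Fin n)) ∧ letI := modelOf ω'; θ.IsFalse (Fin n')) := by
  obtain ⟨d, hφ, hψ, hχ⟩ : ∃ d, (∀ ℓ, quantifierDepth (θ.scheme.φ ℓ) ≤ d) ∧
      (∀ κ, quantifierDepth (θ.scheme.ψ κ) ≤ d) ∧ quantifierDepth
        ((LHom.sumInl : plusLang L →ᴸ stageLang L θ.scheme.m₁).onSentence θ.χ) ≤ d := by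
    refine ⟨∑ ℓ, quantifierDepth (θ.scheme.φ ℓ) + ∑ κ, quantifierDepth (θ.scheme.ψ κ) +
      quantifierDepth ((LHom.sumInl : plusLang L →ᴸ stageLang L θ.scheme.m₁).onSentence θ.χ),
      fun ℓ => ?_, fun κ => ?_, by omega⟩
    · have := Finset.single_le_sum (f := fun ℓ => quantifierDepth (θ.scheme.φ ℓ))
        (fun _ _ => Nat.zero_le _) (Finset.mem_univ ℓ)
      omega
    · have := Finset.single_le_sum (f := fun κ => quantifierDepth (θ.scheme.ψ κ))
        (fun _ _ => Nat.zero_le _) (Finset.mem_univ κ)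
      omega
  obtain ⟨Q, har, hQ⟩ : ∃ Q : ℕ, (∀ κ, θ.scheme.arity κ ≤ Q) ∧ θ.q ≤ Q := by
    refine ⟨∑ κ, θ.scheme.arity κ + ⌈θ.q⌉₊, fun κ => ?_, ?_⟩
    · have := Finset.single_le_sum (f := fun κ => θ.scheme.arity κ)
        (fun _ _ => Nat.zero_le _) (Finset.mem_univ κ)
      omega
    · refine (Nat.le_ceil θ.q).trans ?_
      exact_mod_cast Nat.le_add_left _ _
  -- As `r` grows like `√n`, this `k` makes `r ^ (k + 1)` exceed `n ^ Q`. In `K`, the first term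
  -- pays for shrinking supports of size `Q * k`, the second for quantifiers, the third for test
  -- maps and uniqueness.
  obtain ⟨k, rfl⟩ : ∃ k, k = 2 * Q + 1 := ⟨_, rfl⟩
  obtain ⟨K, hK⟩ : ∃ K, K = 6 * (Q * (2 * Q + 1)) + d * (2 * (2 * Q + 1)) + 10 * (2 * Q + 1) :=
    ⟨_, rfl⟩
  have hK0 : 0 < K := by omega
  refine ⟨fun n => {ω | letI := modelOf ω; IsGeneric (L := L) (fun R => p R = 0)
    (fun R => p R = 1) K (Nat.sqrt (n / K)) (block K (Nat.sqrt (n / K)) (n := n))},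
    tendsto_real_not_isGeneric p hK0, ?_⟩
  filter_upwards [eventually_ge_atTop (((4 * K) ^ Q + 1) * ((4 * K) ^ Q + 1) * K)] with N hN
  have hlarge : ∀ n ≥ N, (4 * K) ^ Q < Nat.sqrt (n / K) := fun n hn =>
    Nat.le_sqrt.2 ((Nat.le_div_iff_mul_le hK0).2 (hN.trans hn))
  have hpos : ∀ n ≥ N, 0 < n := by
    intro n hn
    have := hlarge n hn
    rcases Nat.eq_zero_or_pos n with rfl | h
    · simp at this
    · exact h
  rintro n hn n' hn' ω hω ω' hω' ⟨hT, hF⟩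
  -- The two structures form a family indexed by `Bool`, so that supports are invariant within and
  -- between them.
  let size : Bool → ℕ := fun b => cond b n n'
  have hsize : ∀ b, N ≤ size b := by rintro (_ | _) <;> assumption
  let str : ∀ b, L.Structure (Fin (size b)) := fun b =>
    match b with
    | true => modelOf ω
    | false => modelOf ω'
  have : ∀ b, Nonempty (Fin (size b)) := fun b => ⟨⟨0, hpos _ (hsize b)⟩⟩
  refine not_isTrue_and_isFalse (A := fun b => Fin (size b)) θ (k := 2 * Q + 1) (K := K)
    (Nat.succ_pos _) hK.ge hφ hψ hχ har hQ (P₀ := fun R => p R = 0) (P₁ := fun R => p R = 1)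
    (r := fun b => Nat.sqrt (size b / K))
    (blk := fun b => block K (Nat.sqrt (size b / K))) ?_ ?_ ?_ true false ⟨hT, hF⟩
  · rintro (_ | _)
    · exact hω'
    · exact hω
  · intro b
    rw [Nat.card_fin]
    exact pow_lt_sqrt_pow hK0 (hlarge _ (hsize b))
  · rintro (_ | _) hu
    · obtain ⟨t, ht, -⟩ := hF
      exact hu ⟨t, ht⟩
    · obtain ⟨t, ht, -⟩ := hT
      exact hu ⟨t, ht⟩

/-- If the sentence is true in a single good structure of size at least `N`, it can be false only in
bad ones from `N` on; if there is no such structure, it can be true only in bad ones. -/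
lemma tendsto_probFalse_or_probTrue [IsEmpty (L.Relations 0)] :
    Tendsto (θ.probFalse p) atTop (𝓝 0) ∨ Tendsto (θ.probTrue p) atTop (𝓝 0) := by
  obtain ⟨good, hgood, h⟩ := exists_isGeneric_agree p θ
  obtain ⟨N, h⟩ := h.exists
  by_cases hT : ∃ n ≥ N, ∃ ω ∈ good n, letI := modelOf ω; θ.IsTrue (Fin n)
  · obtain ⟨n, hn, ω, hω, hT⟩ := hT
    refine Or.inl (squeeze_zero' (Eventually.of_forall fun n => measureReal_nonneg) ?_ hgood)
    filter_upwards [eventually_ge_atTop N] with n' hn'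
    exact measureReal_mono fun ω' hF hω' => h n hn n' hn' ω hω ω' hω' ⟨hT, hF⟩
  · push Not at hT
    refine Or.inr (squeeze_zero' (Eventually.of_forall fun n => measureReal_nonneg) ?_ hgood)
    filter_upwards [eventually_ge_atTop N] with n hn
    exact measureReal_mono fun ω hT' hω => hT n hn ω hω hT'

lemma one_le_add_prob (n : ℕ) : 1 ≤ θ.probTrue p n + θ.probFalse p n + θ.probUndefined p n := by
  rw [← probReal_univ (μ := randomModel L p n)]
  refine le_trans (measureReal_mono fun ω _ => ?_)
    ((measureReal_union_le _ _).trans (add_le_add_left (measureReal_union_le _ _) _))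
  let := modelOf ω
  by_cases hu : θ.IsUndefined (Fin n)
  · exact Or.inr hu
  · obtain ⟨t, ht⟩ := not_not.1 hu
    by_cases hχ : θ.χ.Realize (θ.scheme.stage (Fin n) t).carrier
    · exact Or.inl (Or.inl ⟨t, ht, hχ⟩)
    · exact Or.inl (Or.inr ⟨t, ht, hχ⟩)

end CPT

theorem mainTheorem3 (L : FirstOrder.Language.{u, v}) [L.IsRelational] [Fintype (Σ l, L.Relations l)]
    [IsEmpty (L.Relations 0)] (p : (Σ l, L.Relations l) → unitInterval)
    (θ : CPT.PolySentence L) :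
    (Tendsto (θ.probFalse p) atTop (𝓝 0) ∨ Tendsto (θ.probTrue p) atTop (𝓝 0)) ∧
      (Tendsto (θ.probUndefined p) atTop (𝓝 0) →
        Tendsto (θ.probTrue p) atTop (𝓝 1) ∨ Tendsto (θ.probTrue p) atTop (𝓝 0)) := by
  have h := CPT.tendsto_probFalse_or_probTrue p θ
  refine ⟨h, fun hu => ?_⟩
  rcases h with h | h
  · left
    have hlim : Tendsto (fun n => 1 - (θ.probFalse p n + θ.probUndefined p n)) atTop (𝓝 1) := by
      simpa using (h.add hu).const_sub 1
    refine tendsto_of_tendsto_of_tendsto_of_le_of_le hlim tendsto_const_nhds (fun n => ?_)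
      fun n => measureReal_le_one
    have := CPT.one_le_add_prob p θ n
    simp only
    linarith
  · exact Or.inr h
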